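/- The zigzag ladder is the graph with vertex set $\mathbb Z$ and edges $z_m=\{m-1,m\}$ and $h_m=\{m-2,m\}$, $m\in\mathbb Z$. For $c>0$ give each $z_m$ the weight $c$ and each $h_m$ the weight $1$. Let $\mathbf P^c_n$ be the weighted spanning tree measure of the subgraph induced by $\{-n,\dots,n\}$ (a spanning tree $t$ has probability proportional to the product of the weights of its edges). Call a $\{0,1\}^{\mathbb Z}$-valued process $X$ determinantal with Hermitian matrix $A$ if $\mathbf P[X_s=1\ \forall s\in S]=\det\big((A_{s,t})_{s,t\in S}\big)$ for all finite $S\subset\mathbb Z$. A renewal process is a stationary $\{0,1\}^{\mathbb Z}$-valued process for which, given $X_0=1$ (and any event of positive probability $\{X_0=1,\,(X_j)_{j\le -1}\in B\}$), the conditional law of $(X_j)_{j\ge 1}$ does not depend on $B$. Write $\hat f(k)=\int_0^1 f(x)e^{-2\pi i kx}\,dx$. **Theorem.** For $c>0$ the limit $\mathbf P^c=\lim_{n\to\infty}\mathbf P^c_n$ exists (convergence of the probabilities of all cylinder events) and is a probability measure. Moreover, for $c>0$, the relation $\alpha=1+\frac c2-\frac{\sqrt{4c+c^2}}2$ holds if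 and only if $\alpha\in(0,1)$ and $c=(1-\alpha)^2/\alpha$. Let $\alpha\in[0,1)$ and $p\in[0,1]$. For $\alpha>0$ let $c=(1-\alpha)^2/\alpha$, let $T$ be the random spanning tree with law $\mathbf P^c$, and let $X_m=\mathbf 1_{\{z_m\in T\}}$, $m\in\mathbb Z$; for $\alpha=0$ let $c=\infty$ and $X\equiv1$. Let $(Y_m)_{m\in\mathbb Z}$ be i.i.d. Bernoulli($p$) variables independent of $X$, and let $\tilde X_m=X_mY_m$. Let $$f(x)=\frac{c}{c+2-2\cos(2\pi x)}\qquad(f\equiv1\text{ if }\alpha=0).$$ (i) $X$ is determinantal with matrix $A_{k,l}=\hat f(l-k)$, and $\hat f(k)=\frac{1-\alpha}{1+\alpha}\,\alpha^{|k|}$ for all $k\in\mathbb Z$. Equivalently, $X$ is determinantal with matrix $\frac{1-\alpha}{1+\alpha}(-\alpha)^{|l-k|}$. Moreover, $X$ is a renewal process with renewal distribution $$\mathbf P\big[\inf\{k\ge1:X_k=1\}=m\,\big|\,X_0=1\big]=(1-\alpha)^2\,m\,\alpha^{m-1},\qquad m=1,2,\dots\quad(0^0=1).$$ (ii) $\tilde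 X$ is determinantal with matrix $\tilde A=pA$, and $\tilde A_{k,l}=\hat{\tilde f}(l-k)$ with $$\tilde f(x)=\frac{pc}{c+2-2\cos(2\pi x)}\qquad(\tilde f\equiv p\text{ if }\alpha=0).$$ (iii) Every stationary determinantal point process on $\mathbb Z$ with a Hermitian matrix that is also a renewal process has the distribution of $\tilde X$ for some $\alpha\in[0,1)$ and $p\in[0,1]$. -/

import Mathlib

open MeasureTheory ProbabilityTheory Filter Topology

noncomputable section

namespace SpanningLadder

/-! ### Weighted random spanning trees of finite induced subgraphs -/

section FiniteTrees

variable {V : Type*}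

/-- The edges of `G` with both end points in the finite vertex set `S`. -/
def inducedEdges (G : SimpleGraph V) (S : Finset V) : Finset (Sym2 V) :=
  open Classical in S.sym2.filter (fun e => e ∈ G.edgeSet)

/-- The spanning trees of the subgraph of `G` induced by the finite vertex set `S`:
those sets `t` of edges of the induced subgraph for which the graph `(S, t)` is a tree. -/
def spanningTrees (G : SimpleGraph V) (S : Finset V) : Finset (Finset (Sym2 V)) :=
  open Classical in
  (inducedEdges G S).powerset.filter
    (fun t => ((SimpleGraph.fromEdgeSet (t : Set (Sym2 V))).induce (S : Set V)).IsTree)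

/-- The weight of a set of edges is the product of the weights of its elements. -/
def treeWeight (w : Sym2 V → ℝ) (t : Finset (Sym2 V)) : ℝ := ∏ e ∈ t, w e

/-- The total weight of the spanning trees of the induced subgraph. -/
def totalWeight (G : SimpleGraph V) (w : Sym2 V → ℝ) (S : Finset V) : ℝ :=
  ∑ t ∈ spanningTrees G S, treeWeight w t

/-- The indicator function of a set of edges. -/
def edgeIndicator (t : Finset (Sym2 V)) : Sym2 V → Bool :=
  open Classical in fun e => decide (e ∈ t)

/-- The weighted spanning tree measure of the subgraph of `G` induced by `S`, as a measure on
the edge configurations: the spanning tree `t` has probability `w(t) / ∑ w(t')`. -/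
def finiteTreeMeasure (G : SimpleGraph V) (w : Sym2 V → ℝ) (S : Finset V) :
    Measure (Sym2 V → Bool) :=
  ∑ t ∈ spanningTrees G S,
    ENNReal.ofReal (treeWeight w t / totalWeight G w S) • Measure.dirac (edgeIndicator t)

end FiniteTrees

/-- The probability measure `P` is the limit of the measures `Q n` on `{0,1}^E`: the probability
of every cylinder event converges. -/
def IsLimitMeasure {E : Type*} (Q : ℕ → Measure (E → Bool)) (P : Measure (E → Bool)) : Prop :=
  IsProbabilityMeasure P ∧
    ∀ (F : Finset E) (η : E → Bool),
      Tendsto (fun n => Q n {ω | ∀ e ∈ F, ω e = η e}) atTop (𝓝 (P {ω | ∀ e ∈ F, ω e = η e}))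

/-! ### The zigzag ladder -/

/-- The edge `z_m = {m - 1, m}`. -/
def zEdge (m : ℤ) : Sym2 ℤ := s(m - 1, m)

/-- The edge `h_m = {m - k, m}`. -/
def hEdge (k m : ℤ) : Sym2 ℤ := s(m - k, m)

/-- The helix-`k` graph on the vertex set `ℤ`; the zigzag ladder is the case `k = 2`. -/
def helixGraph (k : ℤ) : SimpleGraph ℤ :=
  SimpleGraph.fromEdgeSet (Set.range zEdge ∪ Set.range (hEdge k))

/-- The weight function with weight `c` on the edges `z_m` and weight `1` on the others. -/
def zWeight (c : ℝ) : Sym2 ℤ → ℝ :=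
  open Classical in fun e => if e ∈ Set.range zEdge then c else 1

/-- The weighted spanning tree measure of the zigzag ladder restricted to `{-n, …, n}`. -/
def zigzagFinite (c : ℝ) (n : ℕ) : Measure (Sym2 ℤ → Bool) :=
  finiteTreeMeasure (helixGraph 2) (zWeight c) (Finset.Icc (-(n : ℤ)) n)

/-- The weighted spanning tree measure of the zigzag ladder, the limit of `zigzagFinite c n`
as `n → ∞`. (The value `0` is used if there is no limit; that the limit exists for all `c > 0`
is not built into the definition.) -/
def zigzagTree (c : ℝ) : Measure (Sym2 ℤ → Bool) :=
  open Classical in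
  if h : ∃ P, IsLimitMeasure (zigzagFinite c) P then h.choose else 0

/-- The weight `(1 - α)² / α` of the rungs (meant for `0 < α < 1`). -/
def rungWeight (α : ℝ) : ℝ := (1 - α) ^ 2 / α

/-- The law of the process `X_m = 1_T(z_m)`, where `T` is the random spanning tree of the zigzag
ladder with rung weight `(1 - α)² / α`. For `α = 0` (infinite rung weight), `X ≡ 1`. -/
def rungLaw (α : ℝ) : Measure (ℤ → Bool) :=
  if α = 0 then Measure.dirac (fun _ => true)
  else (zigzagTree (rungWeight α)).map (fun ω m => ω (zEdge m))

/-- The law of `(X_m Y_m)_m`, where `X` has law `μ` and `Y` is an independent family of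
independent Bernoulli variables with parameter `p`. -/
def thinning (p : unitInterval) (μ : Measure (ℤ → Bool)) : Measure (ℤ → Bool) :=
  (μ.prod (Measure.infinitePi (fun _ : ℤ => bernoulliMeasure true false p))).map
    (fun q m => q.1 m && q.2 m)

/-! ### Determinantal processes, regeneration -/

/-- `μ` is the law of a determinantal point process with the Hermitian matrix `A`. -/
def IsDeterminantal {R : Type*} (μ : Measure (R → Bool)) (A : Matrix R R ℂ) : Prop :=
  A.IsHermitian ∧
    ∀ S : Finset R, ((μ.real {x | ∀ s ∈ S, x s = true} : ℝ) : ℂ) =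
      open Classical in (A.submatrix (Subtype.val : S → R) (Subtype.val : S → R)).det

/-- `μ` is invariant under the shift of `{0,1}^ℤ`. -/
def IsStationary (μ : Measure (ℤ → Bool)) : Prop :=
  MeasurePreserving (fun (x : ℤ → Bool) (m : ℤ) => x (m + 1)) μ μ

/-- The event `X(0) = X(-1) = … = X(-k+1) = 1`. -/
def onesEvent (k : ℕ) : Set (ℤ → Bool) := {x | ∀ j : ℕ, j < k → x (-(j : ℤ)) = true}

/-- `μ` is regenerative of order `k`: given `k` successive ones at `0, -1, …, -k+1`, the
process on `{1, 2, …}` does not depend on the process on `{-k, -k-1, …}`. -/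
def IsRegenerative (k : ℕ) (μ : Measure (ℤ → Bool)) : Prop :=
  ∀ (B : Set (Set.Iic (-(k : ℤ)) → Bool)) (C : Set (Set.Ici (1 : ℤ) → Bool)),
    MeasurableSet B → MeasurableSet C →
    μ ((Set.Iic (-(k : ℤ))).domRestrict ⁻¹' B ∩ onesEvent k) ≠ 0 →
    (cond μ ((Set.Iic (-(k : ℤ))).domRestrict ⁻¹' B ∩ onesEvent k))
        ((Set.Ici (1 : ℤ)).domRestrict ⁻¹' C) =
      (cond μ (onesEvent k)) ((Set.Ici (1 : ℤ)).domRestrict ⁻¹' C)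

/-- A (stationary) renewal process: stationary and regenerative of order one. -/
def IsRenewal (μ : Measure (ℤ → Bool)) : Prop := IsStationary μ ∧ IsRegenerative 1 μ

/-- The event that the first `1` at a positive time occurs at time `m`, that is,
`inf {k ≥ 1 : X_k = 1} = m`. -/
def firstOneAt (m : ℕ) : Set (ℤ → Bool) := {x | IsLeast {k : ℕ | 1 ≤ k ∧ x (k : ℤ) = true} m}

/-! ### Fourier transforms -/

/-- `∫_[0,1] f(x) exp(-2πikx) dx`. -/
def fourierInt (f : ℝ → ℝ) (k : ℤ) : ℂ :=
  ∫ x in Set.Icc (0 : ℝ) 1, (f x : ℂ) * Complex.exp (-2 * Real.pi * Complex.I * k * x)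

/-- The Toeplitz matrix `A_{k,l} = f̂(l - k)`. -/
def toeplitz (f : ℝ → ℝ) : Matrix ℤ ℤ ℂ := Matrix.of (fun k l => fourierInt f (l - k))

/-- The function `p c / (c + 2 - 2 cos 2πx)` with `c = (1 - α)² / α`; for `α = 0`, where
`c = ∞`, it is the constant `p`. -/
def density (α p x : ℝ) : ℝ :=
  if α = 0 then p
  else p * rungWeight α / (rungWeight α + 2 - 2 * Real.cos (2 * Real.pi * x))

end SpanningLadder

end

/-! A law on {0,1}^ℤ is determined by its inclusion probabilities P[X = 1 on S] (`ext_of_onesOn`).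
All processes here have inclusion probabilities of the form `HasGaps`: a constant a times the
product of u(d) over the distances d between consecutive points of S. Such a law is stationary and
factorizes at each of its points, so it is a renewal process; thinning replaces (a, u) by (pa, pu).
The principal minors of (a b^|l-k|) have this form with u(d) = a(1 - b^(2d)), by a Schur complement
(`hasGaps_minor_geomToeplitz`). Only b² enters, whence the two matrices in (i).

Parts (i) and (ii) thus reduce to computing the gaps of the rungs (`hasGaps_rungLaw`). The last
vertex of an interval meets only one z-edge and one h-edge. As a leaf it can be removed; with both
edges present it acts like the previous rung. So the tree sum, paired with the sum over
configurations that the last rung completes to a tree, obeys a two-dimensional linear recursion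
(`treeSum_succ`, `splitSum_succ`). Its matrix ((c+1, c), (1, 1)) has determinant 1 and trace c + 2,
hence eigenvalues α and 1/α exactly when c = (1-α)²/α. After normalization the second mode decays
like α^(2k), so cylinder probabilities converge, and compactness provides the limit measure.
Prescribing a rung makes the matrix rank one: the past is forgotten and the gaps are independent.
The return law comes from a linear recursion with double root α (`IsRenewal.exists_gap_recursion`),
and the Fourier coefficients from the Poisson kernel.

For (iii), let a be the intensity, positive without loss of generality. Renewal at the middle point
of {0, d, d+1} turns the 3×3 minor of a Hermitian matrix into an equality case of the
arithmetic-geometric mean inequality. This forces |A(k,k+d)|² = a² b^(2d)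
(`IsRenewal.exists_pair_eq`), which are the gaps of a thinned rung process with α = b and p =
a(1+b)/(1-b). If p exceeded 1, the probability of n successive zeros would solve a second order
recursion with complex roots and could not stay nonnegative (`intensity_le_of_recursion`). -/

noncomputable section

namespace SpanningLadder

/-! ### Laws of `{0,1}`-valued processes -/

section Processes

variable {R : Type*}

/-- The event that the process is `1` on `S`. -/
def onesOn (S : Finset R) : Set (R → Bool) := {x | ∀ s ∈ S, x s = true}

lemma measurableSet_onesOn (S : Finset R) : MeasurableSet (onesOn S) := by
  have : onesOn S = ⋂ s ∈ S, (fun x : R → Bool => x s) ⁻¹' {true} := by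
    ext x; simp [onesOn]
  rw [this]
  exact Finset.measurableSet_biInter _ fun s _ => measurable_pi_apply s (measurableSet_singleton _)

lemma onesOn_empty : onesOn (∅ : Finset R) = Set.univ := by simp [onesOn]

lemma onesOn_union [DecidableEq R] (S T : Finset R) : onesOn (S ∪ T) = onesOn S ∩ onesOn T := by
  ext x; simp only [onesOn, Finset.mem_union, Set.mem_inter_iff, Set.mem_ofPred_eq]; grind

lemma isPiSystem_onesOn : IsPiSystem (Set.range (onesOn : Finset R → Set (R → Bool))) := by
  classical
  rintro _ ⟨S, rfl⟩ _ ⟨T, rfl⟩ -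
  exact ⟨S ∪ T, onesOn_union S T⟩

lemma generateFrom_onesOn : (MeasurableSpace.pi : MeasurableSpace (R → Bool)) =
    MeasurableSpace.generateFrom (Set.range (onesOn : Finset R → Set (R → Bool))) := by
  apply le_antisymm
  · refine iSup_le fun i => ?_
    rintro _ ⟨B, -, rfl⟩
    have h1 : MeasurableSet[MeasurableSpace.generateFrom (Set.range onesOn)]
        ((fun x : R → Bool => x i) ⁻¹' {true}) := by
      apply MeasurableSpace.measurableSet_generateFrom
      exact ⟨{i}, by ext x; simp [onesOn]⟩
    have h2 : Measurable[MeasurableSpace.generateFrom (Set.range onesOn)]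
        (fun x : R → Bool => x i) := by
      refine @measurable_to_bool _ (MeasurableSpace.generateFrom (Set.range onesOn)) _ h1
    exact h2 trivial
  · apply MeasurableSpace.generateFrom_le
    rintro _ ⟨S, rfl⟩
    exact measurableSet_onesOn S

/-- The law of a `{0,1}`-valued process is determined by its inclusion probabilities. -/
lemma ext_of_onesOn {μ ν : Measure (R → Bool)} [IsFiniteMeasure μ]
    (h : ∀ S : Finset R, μ (onesOn S) = ν (onesOn S)) : μ = ν := by
  refine ext_of_generate_finite _ generateFrom_onesOn isPiSystem_onesOn ?_ ?_
  · rintro _ ⟨S, rfl⟩; exact h S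
  · simpa [onesOn_empty] using h ∅

end Processes

lemma measurable_domRestrict {R : Type*} (I : Set R) :
    Measurable (I.domRestrict : (R → Bool) → (I → Bool)) :=
  measurable_pi_lambda _ fun i => measurable_pi_apply (i : R)

lemma preimage_domRestrict_onesOn {R : Type*} (I : Set R) (S : Finset I) :
    (I.domRestrict : (R → Bool) → (I → Bool)) ⁻¹' (onesOn S) =
      onesOn (S.map (Function.Embedding.subtype _)) := by
  ext x; simp [onesOn, Set.domRestrict]

lemma onesEvent_one : onesEvent 1 = onesOn ({0} : Finset ℤ) := by
  ext x; simp [onesEvent, onesOn]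

/-- A process is regenerative as soon as its inclusion probabilities factorize at the origin. -/
lemma isRegenerative_of_onesOn {μ : Measure (ℤ → Bool)} [IsProbabilityMeasure μ]
    (h : ∀ S T : Finset ℤ, (∀ s ∈ S, s < 0) → (∀ s ∈ T, 0 < s) →
      μ (onesOn S ∩ onesOn {0} ∩ onesOn T) * μ (onesOn {0}) =
        μ (onesOn S ∩ onesOn {0}) * μ (onesOn {0} ∩ onesOn T)) :
    IsRegenerative 1 μ := by
  -- With the future event fixed, both sides are finite measures in the past, so agreement on the
  -- events `onesOn S` extends to every B. `key2` then fixes B and extends in the future variable.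
  have key1 : ∀ (T : Finset ℤ), (∀ s ∈ T, 0 < s) →
      ∀ B : Set (Set.Iic (-((1 : ℕ) : ℤ)) → Bool), MeasurableSet B →
      μ ((Set.Iic (-((1 : ℕ) : ℤ))).domRestrict ⁻¹' B ∩ onesOn {0} ∩ onesOn T) * μ (onesOn {0}) =
        μ ((Set.Iic (-((1 : ℕ) : ℤ))).domRestrict ⁻¹' B ∩ onesOn {0})
          * μ (onesOn {0} ∩ onesOn T) := by
    intro T hT B hB
    have hr := measurable_domRestrict (Set.Iic (-((1 : ℕ) : ℤ)))
    have e : (μ (onesOn {0})) •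
        ((μ.restrict (onesOn {0} ∩ onesOn T)).map (Set.Iic (-((1 : ℕ) : ℤ))).domRestrict) =
        (μ (onesOn {0} ∩ onesOn T)) •
        ((μ.restrict (onesOn {0})).map (Set.Iic (-((1 : ℕ) : ℤ))).domRestrict) := by
      have : IsFiniteMeasure ((μ (onesOn {0})) •
        ((μ.restrict (onesOn {0} ∩ onesOn T)).map (Set.Iic (-((1 : ℕ) : ℤ))).domRestrict)) :=
        Measure.smul_finite _ (measure_ne_top _ _)
      apply ext_of_onesOn
      intro S
      simp only [Measure.smul_apply, smul_eq_mul]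
      rw [Measure.map_apply hr (measurableSet_onesOn S), Measure.map_apply hr (measurableSet_onesOn S),
        Measure.restrict_apply (hr (measurableSet_onesOn S)),
        Measure.restrict_apply (hr (measurableSet_onesOn S)), preimage_domRestrict_onesOn,
        ← Set.inter_assoc, mul_comm, h _ T _ hT, mul_comm]
      intro s hs
      simp only [Finset.mem_map, Function.Embedding.subtype_apply] at hs
      obtain ⟨⟨a, ha⟩, -, rfl⟩ := hs
      simp only [Set.mem_Iic] at ha
      push_cast at ha
      show a < 0
      omega
    have e2 := congrArg (fun ν => ν B) e
    simp only [Measure.smul_apply, smul_eq_mul] at e2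
    rw [Measure.map_apply hr hB, Measure.map_apply hr hB, Measure.restrict_apply (hr hB),
      Measure.restrict_apply (hr hB), ← Set.inter_assoc] at e2
    rw [mul_comm, e2, mul_comm]
  have key2 : ∀ (B : Set (Set.Iic (-((1 : ℕ) : ℤ)) → Bool)) (C : Set (Set.Ici (1 : ℤ) → Bool)),
      MeasurableSet B → MeasurableSet C →
      μ ((Set.Iic (-((1 : ℕ) : ℤ))).domRestrict ⁻¹' B ∩ onesOn {0} ∩
          (Set.Ici (1 : ℤ)).domRestrict ⁻¹' C) * μ (onesOn {0}) =
        μ ((Set.Iic (-((1 : ℕ) : ℤ))).domRestrict ⁻¹' B ∩ onesOn {0})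
          * μ (onesOn {0} ∩ (Set.Ici (1 : ℤ)).domRestrict ⁻¹' C) := by
    intro B C hB hC
    have hr := measurable_domRestrict (Set.Ici (1 : ℤ))
    set D := (Set.Iic (-((1 : ℕ) : ℤ))).domRestrict ⁻¹' B ∩ onesOn {0} with hD
    have e : (μ (onesOn {0})) • ((μ.restrict D).map (Set.Ici (1 : ℤ)).domRestrict) =
        (μ D) • ((μ.restrict (onesOn {0})).map (Set.Ici (1 : ℤ)).domRestrict) := by
      have : IsFiniteMeasure
          ((μ (onesOn {0})) • ((μ.restrict D).map (Set.Ici (1 : ℤ)).domRestrict)) :=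
        Measure.smul_finite _ (measure_ne_top _ _)
      apply ext_of_onesOn
      intro S
      simp only [Measure.smul_apply, smul_eq_mul]
      rw [Measure.map_apply hr (measurableSet_onesOn S), Measure.map_apply hr (measurableSet_onesOn S),
        Measure.restrict_apply (hr (measurableSet_onesOn S)),
        Measure.restrict_apply (hr (measurableSet_onesOn S)), preimage_domRestrict_onesOn,
        Set.inter_comm _ D, mul_comm, key1 _ _ B hB, Set.inter_comm (onesOn {0}) (onesOn _)]
      intro s hs
      simp only [Finset.mem_map, Function.Embedding.subtype_apply] at hs
      obtain ⟨⟨a, ha⟩, -, rfl⟩ := hs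
      simp only [Set.mem_Ici] at ha
      show 0 < a
      omega
    have e2 := congrArg (fun ν => ν C) e
    simp only [Measure.smul_apply, smul_eq_mul] at e2
    rw [Measure.map_apply hr hC, Measure.map_apply hr hC, Measure.restrict_apply (hr hC),
      Measure.restrict_apply (hr hC), Set.inter_comm _ D, Set.inter_comm _ (onesOn {0})] at e2
    rw [mul_comm, e2]
  intro B C hB hC hne
  rw [onesEvent_one] at hne ⊢
  have hm0 := measurableSet_onesOn ({0} : Finset ℤ)
  have hmD := ((measurable_domRestrict (Set.Iic (-((1 : ℕ) : ℤ)))) hB).inter hm0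
  have h0 : μ (onesOn {0}) ≠ 0 := fun h0 =>
    hne (measure_mono_null Set.inter_subset_right h0)
  rw [cond_apply hmD, cond_apply hm0, ← ENNReal.div_eq_inv_mul, ← ENNReal.div_eq_inv_mul,
    ENNReal.div_eq_div_iff h0 (measure_ne_top _ _) hne (measure_ne_top _ _), mul_comm,
    key2 B C hB hC]

/-- If the cylinder probabilities of a sequence of probability measures on `{0,1}^E` converge,
then the limits are the cylinder probabilities of a probability measure. -/
lemma exists_isLimitMeasure {E : Type*} [Countable E] (Q : ℕ → Measure (E → Bool))
    (hQ : ∀ᶠ n in atTop, IsProbabilityMeasure (Q n))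
    (h : ∀ (F : Finset E) (η : E → Bool), ∃ L : ENNReal,
      Tendsto (fun n => Q n {ω | ∀ e ∈ F, ω e = η e}) atTop (𝓝 L)) :
    ∃ P, IsLimitMeasure Q P := by
  obtain ⟨N, hN⟩ := eventually_atTop.1 hQ
  let q : ℕ → ProbabilityMeasure (E → Bool) := fun n =>
    ⟨Q (n + N), hN _ (Nat.le_add_left _ _)⟩
  let U : Ultrafilter ℕ := Ultrafilter.of atTop
  have hU : (U : Filter ℕ) ≤ atTop := Ultrafilter.of_le _
  -- Probability measures on the compact space {0,1}^E form a compact space, so the sequence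
  -- converges along an ultrafilter. Cylinders are clopen, hence have empty frontier, and the limits
  -- assumed along `atTop` must be their probabilities under P.
  obtain ⟨P, -, hP⟩ := (isCompact_univ (X := ProbabilityMeasure (E → Bool))).ultrafilter_le_nhds
    (U.map q) (by simp)
  have hP' : Tendsto q U (𝓝 P) := hP
  refine ⟨P, inferInstance, fun F η => ?_⟩
  obtain ⟨L, hL⟩ := h F η
  have hclopen : IsClopen {ω : E → Bool | ∀ e ∈ F, ω e = η e} := by
    have : {ω : E → Bool | ∀ e ∈ F, ω e = η e} = ⋂ e ∈ F, (fun ω : E → Bool => ω e) ⁻¹' {η e} := by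
      ext; simp
    rw [this]
    exact isClopen_biInter_finset fun e _ => (isClopen_discrete _).preimage (continuous_apply e)
  have h1 := ProbabilityMeasure.tendsto_measure_of_null_frontier_of_tendsto' hP'
    (E := {ω : E → Bool | ∀ e ∈ F, ω e = η e}) (by simp [hclopen.frontier_eq])
  have h2 : Tendsto (fun n => Q (n + N) {ω | ∀ e ∈ F, ω e = η e}) U (𝓝 L) :=
    (hL.comp (tendsto_add_atTop_nat N)).mono_left hU
  rwa [tendsto_nhds_unique h1 h2]

/-! ### Set functions with independent gaps -/

/-- The set function `f` is the product of the gap weights `u (s_{i+1} - s_i)` over the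
consecutive elements of the set, multiplied by `a` if the set is not empty. -/
structure HasGaps {K : Type*} [CommRing K] (f : Finset ℤ → K) (a : K) (u : ℕ → K) : Prop where
  empty : f ∅ = 1
  singleton : ∀ t, f {t} = a
  insert_insert : ∀ (S : Finset ℤ) (s t : ℤ), (∀ x ∈ S, x < s) → s < t →
    f (insert t (insert s S)) = f (insert s S) * u (t - s).toNat

lemma exists_eq_insert_of_nonempty {S : Finset ℤ} (hS : S.Nonempty) :
    ∃ T s, S = insert s T ∧ ∀ x ∈ T, x < s := by
  refine ⟨S.erase (S.max' hS), S.max' hS, (Finset.insert_erase (S.max'_mem hS)).symm, ?_⟩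
  intro x hx
  exact lt_of_le_of_ne (S.le_max' x (Finset.mem_of_mem_erase hx)) (Finset.ne_of_mem_erase hx)

namespace HasGaps

variable {K : Type*} [CommRing K] {f g : Finset ℤ → K} {a : K} {u : ℕ → K}

lemma unique (hf : HasGaps f a u) (hg : HasGaps g a u) (S : Finset ℤ) : f S = g S := by
  induction S using Finset.induction_on_max with
  | empty => rw [hf.empty, hg.empty]
  | insert t S hS ih =>
    rcases S.eq_empty_or_nonempty with rfl | hne
    · simp [hf.singleton, hg.singleton]
    · obtain ⟨T, s, rfl, hT⟩ := exists_eq_insert_of_nonempty hne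
      have hst := hS s (Finset.mem_insert_self _ _)
      rw [hf.insert_insert T s t hT hst, hg.insert_insert T s t hT hst, ih]

lemma shift (hf : HasGaps f a u) (k : ℤ) : HasGaps (fun S => f (S.image (· + k))) a u where
  empty := by simp [hf.empty]
  singleton t := by simp [hf.singleton]
  insert_insert S s t hS hst := by
    rw [Finset.image_insert, Finset.image_insert, hf.insert_insert _ _ _ _ (by omega)]
    · congr 3; omega
    · intro x hx
      obtain ⟨y, hy, rfl⟩ := Finset.mem_image.1 hx
      have := hS y hy
      omega

/-- The factorization of the gaps at a point `r` of the set. -/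
lemma factor (hf : HasGaps f a u) (r : ℤ) (S T : Finset ℤ) (hS : ∀ s ∈ S, s < r)
    (hT : ∀ s ∈ T, r < s) :
    f (T ∪ insert r S) * a = f (insert r S) * f (T ∪ {r}) := by
  induction T using Finset.induction_on_max with
  | empty => simp [hf.singleton]
  | insert t T hTt ih =>
    have ih' := ih fun s hs => hT s (Finset.mem_insert_of_mem hs)
    have hrt := hT t (Finset.mem_insert_self _ _)
    rcases T.eq_empty_or_nonempty with rfl | hne
    · have h1 := hf.insert_insert S r t hS hrt
      have h2 := hf.insert_insert ∅ r t (by simp) hrt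
      simp only [insert_empty_eq, hf.singleton] at h2
      rw [Finset.insert_union, Finset.insert_union, Finset.empty_union, Finset.empty_union, h1, h2]
      ring
    · obtain ⟨V, s, rfl, hV⟩ := exists_eq_insert_of_nonempty hne
      have hst := hTt s (Finset.mem_insert_self _ _)
      have hrs := hT s (by simp)
      rw [Finset.insert_union, Finset.insert_union, Finset.insert_union, Finset.insert_union,
        hf.insert_insert _ s t _ hst, hf.insert_insert _ s t _ hst]
      · rw [Finset.insert_union, Finset.insert_union] at ih'
        linear_combination u (t - s).toNat * ih'
      · intro x hx
        rcases Finset.mem_union.1 hx with hx | hx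
        · exact hV x hx
        · rw [Finset.mem_singleton.1 hx]; exact hrs
      · intro x hx
        rcases Finset.mem_union.1 hx with hx | hx
        · exact hV x hx
        · rcases Finset.mem_insert.1 hx with rfl | hx
          · exact hrs
          · exact (hS x hx).trans hrs

lemma thin (hf : HasGaps f a u) (p : K) :
    HasGaps (fun S => p ^ S.card * f S) (p * a) (fun d => p * u d) where
  empty := by simp [hf.empty]
  singleton t := by simp [hf.singleton]
  insert_insert S s t hS hst := by
    have : t ∉ insert s S := by
      intro h
      rcases Finset.mem_insert.1 h with rfl | h
      · exact lt_irrefl _ hst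
      · exact lt_irrefl _ (hst.trans (hS t h))
    rw [hf.insert_insert S s t hS hst, Finset.card_insert_of_notMem this]
    ring

lemma map {L : Type*} [CommRing L] (hf : HasGaps f a u) (φ : K →+* L) :
    HasGaps (fun S => φ (f S)) (φ a) (fun d => φ (u d)) where
  empty := by simp [hf.empty]
  singleton t := by simp [hf.singleton]
  insert_insert S s t hS hst := by simp [hf.insert_insert S s t hS hst]

end HasGaps

/-! ### Principal minors of geometric Toeplitz matrices -/

/-- Block elimination that never inverts `A`; the minors to which it is applied may vanish. -/
lemma det_fromBlocks_of_mul {K m n : Type*} [CommRing K] [Fintype m] [DecidableEq m] [Fintype n]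
    [DecidableEq n] (A : Matrix m m K) (B : Matrix m n K) (D : Matrix n n K) (X : Matrix n m K) :
    (Matrix.fromBlocks A B (X * A) D).det = A.det * (D - X * B).det := by
  have : Matrix.fromBlocks A B (X * A) D =
      Matrix.fromBlocks 1 0 X 1 * Matrix.fromBlocks A B 0 (D - X * B) := by
    simp [Matrix.fromBlocks_multiply]
  rw [this, Matrix.det_mul, Matrix.det_fromBlocks_zero₁₂, Matrix.det_fromBlocks_zero₂₁]
  simp

/-- The principal minor of `A` on `S`. -/
def minor {R : Type*} (A : Matrix R R ℂ) (S : Finset R) : ℂ :=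
  open Classical in (A.submatrix (Subtype.val : S → R) (Subtype.val : S → R)).det

/-- If on `S` the row of `t` is `b` times the row of `s`, then the minor factorizes. -/
lemma minor_insert_of_row {R : Type*} [DecidableEq R] (A : Matrix R R ℂ) (S : Finset R) (s t : R)
    (hs : s ∈ S) (ht : t ∉ S) (b : ℂ) (h : ∀ x ∈ S, A t x = b * A s x) :
    minor A (insert t S) = minor A S * (A t t - b * A s t) := by
  classical
  let e : (S ⊕ Unit) ≃ {x // x ∈ insert t S} :=
    ((Finset.subtypeInsertEquivOption ht).trans (Equiv.optionEquivSumPUnit _)).symm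
  have he1 : ∀ x : S, ((e (Sum.inl x) : {x // x ∈ insert t S}) : R) = x := fun x => by
    simp [e, Finset.subtypeInsertEquivOption]
  have he2 : ((e (Sum.inr ()) : {x // x ∈ insert t S}) : R) = t := by
    simp [e, Finset.subtypeInsertEquivOption]
  -- `X` picks b times the row of s, so `X * A` is the row of t on S and the Schur complement is a
  -- single number.
  let X : Matrix Unit S ℂ := Matrix.of fun _ x => if x = ⟨s, hs⟩ then b else 0
  have hX : ∀ (n : Type _) (B : Matrix S n ℂ) (j : n), (X * B) () j = b * B ⟨s, hs⟩ j := by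
    intro n B j
    simp [Matrix.mul_apply, X, ite_mul]
  have hX' : ∀ j : S, (X * A.submatrix (Subtype.val : S → R) Subtype.val) () j = b * A s j := by
    intro j
    simp [Matrix.mul_apply, X, ite_mul]
  have h1 : (A.submatrix (Subtype.val : {x // x ∈ insert t S} → R) Subtype.val).submatrix e e =
      Matrix.fromBlocks (A.submatrix (Subtype.val : S → R) Subtype.val)
        (Matrix.of fun (x : S) (_ : Unit) => A x t)
        (X * (A.submatrix (Subtype.val : S → R) Subtype.val))
        (Matrix.of fun (_ _ : Unit) => A t t) := by
    ext i j
    rcases i with i | i <;> rcases j with j | j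
    · simp [he1]
    · simp [he1, he2]
    · rw [Matrix.fromBlocks_apply₂₁, hX']
      simp [he1, he2, h j j.2]
    · simp [he2]
  have h2 : (A.submatrix (Subtype.val : {x // x ∈ insert t S} → R) Subtype.val).det =
      (A.submatrix (Subtype.val : S → R) Subtype.val).det * (A t t - b * A s t) := by
    rw [← Matrix.det_submatrix_equiv_self e, h1, det_fromBlocks_of_mul,
      Matrix.det_unique (n := Unit)]
    congr 1
    exact congrArg (fun z => A t t - z) (hX Unit _ _)
  unfold minor
  convert h2

lemma minor_empty {R : Type*} (A : Matrix R R ℂ) : minor A ∅ = 1 := by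
  classical
  have h : (A.submatrix (Subtype.val : {x // x ∈ (∅ : Finset R)} → R) Subtype.val).det = 1 := by
    rw [Matrix.det_apply]
    simp
  unfold minor
  convert h

lemma minor_singleton {R : Type*} (A : Matrix R R ℂ) (t : R) : minor A {t} = A t t := by
  classical
  let e : Unit ≃ {x // x ∈ ({t} : Finset R)} :=
    ⟨fun _ => ⟨t, Finset.mem_singleton_self t⟩, fun _ => (), fun _ => rfl, fun x => by
      ext; exact (Finset.mem_singleton.1 x.2).symm⟩
  have h : (A.submatrix (Subtype.val : {x // x ∈ ({t} : Finset R)} → R) Subtype.val).det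
      = A t t := by
    rw [← Matrix.det_submatrix_equiv_self e, Matrix.det_unique (n := Unit)]
    rfl
  unfold minor
  convert h

/-- The matrix with entries `a b^|l-k|`. -/
def geomToeplitz (a b : ℂ) : Matrix ℤ ℤ ℂ := Matrix.of fun k l => a * b ^ (l - k).natAbs

/-- Every index x of the set is at most s, so |x - t| = (t - s) + |x - s| and the row of t is
b^(t-s) times the row of s. The Schur complement is a - b^(t-s) · a b^(t-s). -/
lemma hasGaps_minor_geomToeplitz (a b : ℂ) :
    HasGaps (minor (geomToeplitz a b)) a (fun d => a * (1 - b ^ (2 * d))) where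
  empty := minor_empty (geomToeplitz a b)
  singleton t := by simp [minor_singleton, geomToeplitz]
  insert_insert S s t hS hst := by
    have ht : t ∉ insert s S := by
      intro h
      rcases Finset.mem_insert.1 h with rfl | h
      · exact lt_irrefl _ hst
      · exact lt_irrefl _ (hst.trans (hS t h))
    rw [minor_insert_of_row _ _ s t (Finset.mem_insert_self _ _) ht (b ^ (t - s).toNat)]
    · have h1 : (t - s).natAbs = (t - s).toNat := by omega
      simp only [geomToeplitz, Matrix.of_apply, sub_self, Int.natAbs_zero, pow_zero, mul_one, h1]
      ring
    · intro x hx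
      have hxs : x ≤ s := by
        rcases Finset.mem_insert.1 hx with rfl | h
        · exact le_rfl
        · exact (hS x h).le
      have : (x - t).natAbs = (t - s).toNat + (x - s).natAbs := by omega
      simp only [geomToeplitz, Matrix.of_apply, this, pow_add]
      ring

/-! ### Trees on a finite vertex set -/

section Trees

variable {V W : Type*}

/-- Adjacent points need only have connected images, which covers contractions and the replacement
of an edge by a path. -/
lemma reachable_of_map {G : SimpleGraph V} {H : SimpleGraph W} (φ : V → W)
    (h : ∀ x y, G.Adj x y → H.Reachable (φ x) (φ y)) {x y : V} (hxy : G.Reachable x y) :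
    H.Reachable (φ x) (φ y) := by
  obtain ⟨p⟩ := hxy
  induction p with
  | nil => exact SimpleGraph.Reachable.refl _
  | cons hadj _ ih => exact (h _ _ hadj).trans ih

/-- The vertices of `S` are connected by edges of `t`. -/
def ConnOn (S : Finset V) (t : Finset (Sym2 V)) : Prop :=
  ∀ x ∈ S, ∀ y ∈ S, (SimpleGraph.fromEdgeSet (t : Set (Sym2 V))).Reachable x y

/-- `(S, t)` is a tree. -/
def IsTreeOn (S : Finset V) (t : Finset (Sym2 V)) : Prop :=
  ((SimpleGraph.fromEdgeSet (t : Set (Sym2 V))).induce (S : Set V)).IsTree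

/-- The set `t` consists of edges between different points of `S`. -/
def EdgesIn (S : Finset V) (t : Finset (Sym2 V)) : Prop :=
  ∀ e ∈ t, ¬ e.IsDiag ∧ ∀ v ∈ e, v ∈ S

/-- A walk along edges of `t` that starts in `S` never leaves `S`. Connectivity can therefore be
studied in the graph on all of `V`. -/
lemma connected_induce_iff {S : Finset V} {t : Finset (Sym2 V)} (hS : S.Nonempty)
    (ht : EdgesIn S t) :
    ((SimpleGraph.fromEdgeSet (t : Set (Sym2 V))).induce (S : Set V)).Connected ↔ ConnOn S t := by
  constructor
  · intro h x hx y hy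
    exact (h.preconnected ⟨x, hx⟩ ⟨y, hy⟩).map (SimpleGraph.Embedding.induce _).toHom
  · intro h
    have : Nonempty (S : Set V) := hS.to_subtype
    refine ⟨fun x y => ?_⟩
    obtain ⟨x, hx⟩ := x
    obtain ⟨y, hy⟩ := y
    have key : ∀ {x y : V} (_ : (SimpleGraph.fromEdgeSet (t : Set (Sym2 V))).Walk x y)
        (hx : x ∈ (S : Set V)) (hy : y ∈ (S : Set V)),
        ((SimpleGraph.fromEdgeSet (t : Set (Sym2 V))).induce (S : Set V)).Reachable
          ⟨x, hx⟩ ⟨y, hy⟩ := by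
      intro x y p
      induction p with
      | nil => intro _ _; exact SimpleGraph.Reachable.refl _
      | @cons u v w hadj _ ih =>
        intro hu hw
        have hv : v ∈ (S : Set V) :=
          (ht s(u, v) ((SimpleGraph.fromEdgeSet_adj _).1 hadj).1).2 v (Sym2.mem_mk_right u v)
        refine SimpleGraph.Reachable.trans (SimpleGraph.Adj.reachable ?_) (ih hv hw)
        exact hadj
    obtain ⟨p⟩ := h x hx y hy
    exact key p hx hy

lemma card_edgeSet_induce {S : Finset V} {t : Finset (Sym2 V)} (ht : EdgesIn S t) :
    Nat.card ((SimpleGraph.fromEdgeSet (t : Set (Sym2 V))).induce (S : Set V)).edgeSet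
      = t.card := by
  have h : Sym2.map (Subtype.val : {x // x ∈ (S : Set V)} → V) ''
      ((SimpleGraph.fromEdgeSet (t : Set (Sym2 V))).induce (S : Set V)).edgeSet = t := by
    ext e
    constructor
    · rintro ⟨e, he, rfl⟩
      induction e using Sym2.ind with
      | _ x y => exact ((SimpleGraph.fromEdgeSet_adj _).1 he).1
    · intro he
      induction e using Sym2.ind with
      | _ x y =>
        have := ht _ he
        refine ⟨s(⟨x, this.2 x (Sym2.mem_mk_left x y)⟩, ⟨y, this.2 y (Sym2.mem_mk_right x y)⟩),
          ?_, rfl⟩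
        exact (SimpleGraph.fromEdgeSet_adj _).2 ⟨he, fun h => this.1 h⟩
  rw [Nat.card_coe_set_eq, ← Set.ncard_image_of_injective _
    (Sym2.map.injective Subtype.val_injective), h, Set.ncard_coe_finset]

lemma ConnOn.card_le {S : Finset V} {t : Finset (Sym2 V)} (hS : S.Nonempty) (ht : EdgesIn S t)
    (h : ConnOn S t) : S.card ≤ t.card + 1 := by
  have := ((connected_induce_iff hS ht).2 h).card_vert_le_card_edgeSet_add_one
  rwa [card_edgeSet_induce ht, Nat.card_coe_set_eq, Set.ncard_coe_finset] at this

lemma isTreeOn_iff {S : Finset V} {t : Finset (Sym2 V)} (hS : S.Nonempty) (ht : EdgesIn S t) :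
    IsTreeOn S t ↔ ConnOn S t ∧ t.card + 1 = S.card := by
  unfold IsTreeOn
  have : Finite (S : Set V) := inferInstanceAs (Finite S)
  rw [SimpleGraph.isTree_iff_connected_and_card, connected_induce_iff hS ht,
    card_edgeSet_induce ht, Nat.card_coe_set_eq, Set.ncard_coe_finset]

end Trees

/-! ### The spanning trees of an interval of the ladder -/

lemma zEdge_eq_iff (m x y : ℤ) : zEdge m = s(x, y) ↔ x = m - 1 ∧ y = m ∨ x = m ∧ y = m - 1 := by
  unfold zEdge; rw [Sym2.eq_iff]; grind

lemma hEdge_eq_iff (m x y : ℤ) :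
    hEdge 2 m = s(x, y) ↔ x = m - 2 ∧ y = m ∨ x = m ∧ y = m - 2 := by
  unfold hEdge; rw [Sym2.eq_iff]; grind

lemma zEdge_injective : Function.Injective zEdge := by
  intro m n h
  unfold zEdge at h
  rw [Sym2.eq_iff] at h
  omega

lemma zEdge_ne_hEdge (m n : ℤ) : zEdge m ≠ hEdge 2 n := by
  unfold zEdge hEdge
  rw [Ne, Sym2.eq_iff]
  omega

/-- The edges of the ladder between points of `[a, b]`. -/
def ladderEdges (a b : ℤ) : Finset (Sym2 ℤ) := inducedEdges (helixGraph 2) (Finset.Icc a b)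

lemma mem_ladderEdges {a b : ℤ} {e : Sym2 ℤ} : e ∈ ladderEdges a b ↔
    (∃ m, a + 1 ≤ m ∧ m ≤ b ∧ e = zEdge m) ∨ ∃ m, a + 2 ≤ m ∧ m ≤ b ∧ e = hEdge 2 m := by
  unfold ladderEdges inducedEdges
  refine (@Finset.mem_filter _ _ (_) _ _).trans ?_
  unfold helixGraph
  induction e using Sym2.ind with
  | _ x y =>
    rw [Finset.mk_mem_sym2_iff, SimpleGraph.mem_edgeSet, SimpleGraph.fromEdgeSet_adj,
      Finset.mem_Icc, Finset.mem_Icc]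
    constructor
    · rintro ⟨⟨hx, hy⟩, ⟨m, hm⟩ | ⟨m, hm⟩, hne⟩
      · left
        have := (zEdge_eq_iff m x y).1 hm
        exact ⟨m, by omega, by omega, hm.symm⟩
      · right
        have := (hEdge_eq_iff m x y).1 hm
        exact ⟨m, by omega, by omega, hm.symm⟩
    · rintro (⟨m, h1, h2, h3⟩ | ⟨m, h1, h2, h3⟩)
      · have := (zEdge_eq_iff m x y).1 h3.symm
        exact ⟨⟨by omega, by omega⟩, Or.inl ⟨m, h3.symm⟩, by omega⟩
      · have := (hEdge_eq_iff m x y).1 h3.symm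
        exact ⟨⟨by omega, by omega⟩, Or.inr ⟨m, h3.symm⟩, by omega⟩

lemma ladderEdges_succ {a b : ℤ} (hab : a + 1 ≤ b) :
    ladderEdges a (b + 1) = insert (zEdge (b + 1)) (insert (hEdge 2 (b + 1)) (ladderEdges a b)) := by
  ext e
  rw [Finset.mem_insert, Finset.mem_insert, mem_ladderEdges, mem_ladderEdges]
  constructor
  · rintro (⟨m, h1, h2, rfl⟩ | ⟨m, h1, h2, rfl⟩)
    · rcases h2.eq_or_lt with rfl | h
      · exact Or.inl rfl
      · exact Or.inr (Or.inr (Or.inl ⟨m, h1, by omega, rfl⟩))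
    · rcases h2.eq_or_lt with rfl | h
      · exact Or.inr (Or.inl rfl)
      · exact Or.inr (Or.inr (Or.inr ⟨m, h1, by omega, rfl⟩))
  · rintro (rfl | rfl | ⟨m, h1, h2, rfl⟩ | ⟨m, h1, h2, rfl⟩)
    · exact Or.inl ⟨_, by omega, by omega, rfl⟩
    · exact Or.inr ⟨_, by omega, by omega, rfl⟩
    · exact Or.inl ⟨m, h1, by omega, rfl⟩
    · exact Or.inr ⟨m, h1, by omega, rfl⟩

lemma ladderEdges_start (a : ℤ) : ladderEdges a (a + 1) = {zEdge (a + 1)} := by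
  ext e
  rw [Finset.mem_singleton, mem_ladderEdges]
  constructor
  · rintro (⟨m, h1, h2, rfl⟩ | ⟨m, h1, h2, rfl⟩)
    · rw [show m = a + 1 by omega]
    · omega
  · rintro rfl
    exact Or.inl ⟨_, by omega, by omega, rfl⟩

lemma edgesIn_of_subset {a b : ℤ} {t : Finset (Sym2 ℤ)} (ht : t ⊆ ladderEdges a b) :
    EdgesIn (Finset.Icc a b) t := by
  intro e he
  rcases mem_ladderEdges.1 (ht he) with ⟨m, h1, h2, rfl⟩ | ⟨m, h1, h2, rfl⟩
  · refine ⟨by simp [zEdge], fun v hv => ?_⟩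
    rcases Sym2.mem_iff.1 hv with rfl | rfl <;> rw [Finset.mem_Icc] <;> omega
  · refine ⟨by simp [hEdge], fun v hv => ?_⟩
    rcases Sym2.mem_iff.1 hv with rfl | rfl <;> rw [Finset.mem_Icc] <;> omega

lemma zEdge_notMem {a b m : ℤ} (h : b < m) : zEdge m ∉ ladderEdges a b := by
  intro hm
  rcases mem_ladderEdges.1 hm with ⟨k, h1, h2, h3⟩ | ⟨k, h1, h2, h3⟩
  · have := zEdge_injective h3; omega
  · exact zEdge_ne_hEdge _ _ h3

lemma hEdge_notMem {a b m : ℤ} (h : b < m) : hEdge 2 m ∉ ladderEdges a b := by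
  intro hm
  rcases mem_ladderEdges.1 hm with ⟨k, h1, h2, h3⟩ | ⟨k, h1, h2, h3⟩
  · exact zEdge_ne_hEdge _ _ h3.symm
  · unfold hEdge at h3; rw [Sym2.eq_iff] at h3; omega

lemma zEdge_mem {a b m : ℤ} (h : a + 1 ≤ m) (h' : m ≤ b) : zEdge m ∈ ladderEdges a b :=
  mem_ladderEdges.2 (Or.inl ⟨m, h, h', rfl⟩)

section Recursion

variable {a b : ℤ} {t : Finset (Sym2 ℤ)}

lemma adj_zEdge {s : Set (Sym2 ℤ)} {m : ℤ} (h : zEdge m ∈ s) :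
    (SimpleGraph.fromEdgeSet s).Reachable (m - 1) m :=
  SimpleGraph.Adj.reachable ((SimpleGraph.fromEdgeSet_adj _).2 ⟨h, by omega⟩)

lemma adj_hEdge {s : Set (Sym2 ℤ)} {m : ℤ} (h : hEdge 2 m ∈ s) :
    (SimpleGraph.fromEdgeSet s).Reachable (m - 2) m :=
  SimpleGraph.Adj.reachable ((SimpleGraph.fromEdgeSet_adj _).2 ⟨h, by omega⟩)

lemma ConnOn.mono {V : Type*} {S : Finset V} {t t' : Finset (Sym2 V)} (h : ConnOn S t)
    (htt' : t ⊆ t') : ConnOn S t' := fun x hx y hy =>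
  (h x hx y hy).mono (SimpleGraph.fromEdgeSet_mono (by exact_mod_cast htt'))

/-- Contracting the last point of `[a, b + 1]` to a point `c`. -/
lemma ConnOn.contract (c : ℤ) {t' : Finset (Sym2 ℤ)} (ht : t ⊆ ladderEdges a b) {r : Finset (Sym2 ℤ)}
    (h : ConnOn (Finset.Icc a (b + 1)) (t' ∪ t)) (htr : t ⊆ r)
    (ht' : ∀ x y, s(x, y) ∈ t' → (SimpleGraph.fromEdgeSet (r : Set (Sym2 ℤ))).Reachable
      (if x = b + 1 then c else x) (if y = b + 1 then c else y)) :
    ConnOn (Finset.Icc a b) r := by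
  intro x hx y hy
  rw [Finset.mem_Icc] at hx hy
  have hxy := h x (Finset.mem_Icc.2 (by omega)) y (Finset.mem_Icc.2 (by omega))
  have key := reachable_of_map (H := SimpleGraph.fromEdgeSet (r : Set (Sym2 ℤ)))
    (fun x => if x = b + 1 then c else x) ?_ hxy
  · rwa [if_neg (by omega), if_neg (by omega)] at key
  · intro u v huv
    obtain ⟨h1, h2⟩ := (SimpleGraph.fromEdgeSet_adj _).1 huv
    rw [Finset.mem_coe, Finset.mem_union] at h1
    rcases h1 with h1 | h1
    · exact ht' u v h1
    · have h3 := edgesIn_of_subset ht _ h1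
      have hu := Finset.mem_Icc.1 (h3.2 u (Sym2.mem_mk_left u v))
      have hv := Finset.mem_Icc.1 (h3.2 v (Sym2.mem_mk_right u v))
      rw [if_neg (by omega), if_neg (by omega)]
      exact SimpleGraph.Adj.reachable ((SimpleGraph.fromEdgeSet_adj _).2 ⟨htr h1, h2⟩)

/-- Adding the last point of `[a, b + 1]`. -/
lemma ConnOn.extend (c : ℤ) (hc : a ≤ c ∧ c ≤ b) {t' r : Finset (Sym2 ℤ)}
    (h : ConnOn (Finset.Icc a b) t')
    (hr : ∀ x y, s(x, y) ∈ t' → (SimpleGraph.fromEdgeSet (r : Set (Sym2 ℤ))).Reachable x y)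
    (hcr : (SimpleGraph.fromEdgeSet (r : Set (Sym2 ℤ))).Reachable c (b + 1)) :
    ConnOn (Finset.Icc a (b + 1)) r := by
  have h1 : ∀ x ∈ Finset.Icc a (b + 1),
      (SimpleGraph.fromEdgeSet (r : Set (Sym2 ℤ))).Reachable x c := by
    intro x hx
    rw [Finset.mem_Icc] at hx
    rcases hx.2.eq_or_lt with rfl | hlt
    · exact hcr.symm
    · exact reachable_of_map id (fun u v huv => hr u v ((SimpleGraph.fromEdgeSet_adj _).1 huv).1)
        (h x (Finset.mem_Icc.2 (by omega)) c (Finset.mem_Icc.2 hc))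
  exact fun x hx y hy => (h1 x hx).trans (h1 y hy).symm

lemma subset_ladderEdges_succ (hab : a + 1 ≤ b) (ht : t ⊆ ladderEdges a b) :
    t ⊆ ladderEdges a (b + 1) ∧ insert (zEdge (b + 1)) t ⊆ ladderEdges a (b + 1) ∧
    insert (hEdge 2 (b + 1)) t ⊆ ladderEdges a (b + 1) ∧
    insert (zEdge (b + 1)) (insert (hEdge 2 (b + 1)) t) ⊆ ladderEdges a (b + 1) := by
  rw [ladderEdges_succ hab]
  grind

lemma card_Icc_succ (hab : a ≤ b) :
    (Finset.Icc a (b + 1)).card = (Finset.Icc a b).card + 1 := by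
  rw [Int.card_Icc, Int.card_Icc]; omega

/-- The vertex b + 1 is isolated: the predicate `x = b + 1` is constant along the edges of `t`. -/
lemma not_isTreeOn_succ (hab : a + 1 ≤ b) (ht : t ⊆ ladderEdges a b) :
    ¬ IsTreeOn (Finset.Icc a (b + 1)) t := by
  have hne : (Finset.Icc a (b + 1)).Nonempty := ⟨a, Finset.mem_Icc.2 (by omega)⟩
  have hne' : (Finset.Icc a b).Nonempty := ⟨a, Finset.mem_Icc.2 (by omega)⟩
  rw [isTreeOn_iff hne (edgesIn_of_subset (subset_ladderEdges_succ hab ht).1)]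
  rintro ⟨h, -⟩
  have h1 := h b (Finset.mem_Icc.2 (by omega)) (b + 1) (Finset.mem_Icc.2 (by omega))
  have key := reachable_of_map (H := (⊥ : SimpleGraph Prop)) (fun x => x = b + 1) ?_ h1
  · rw [SimpleGraph.reachable_bot] at key
    have : b = b + 1 := by rw [key]
    omega
  · intro u v huv
    obtain ⟨h1, h2⟩ := (SimpleGraph.fromEdgeSet_adj _).1 huv
    have h3 := edgesIn_of_subset ht _ h1
    have hu := Finset.mem_Icc.1 (h3.2 u (Sym2.mem_mk_left u v))
    have hv := Finset.mem_Icc.1 (h3.2 v (Sym2.mem_mk_right u v))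
    rw [SimpleGraph.reachable_bot]
    apply propext
    constructor <;> intro h <;> omega

/-- The vertex b + 1 is a leaf hanging from b, so it can be contracted into b or attached again;
vertices and edges both change by one. -/
lemma isTreeOn_insert_zEdge (hab : a + 1 ≤ b) (ht : t ⊆ ladderEdges a b) :
    IsTreeOn (Finset.Icc a (b + 1)) (insert (zEdge (b + 1)) t) ↔ IsTreeOn (Finset.Icc a b) t := by
  have hne : (Finset.Icc a (b + 1)).Nonempty := ⟨a, Finset.mem_Icc.2 (by omega)⟩
  have hne' : (Finset.Icc a b).Nonempty := ⟨a, Finset.mem_Icc.2 (by omega)⟩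
  rw [isTreeOn_iff hne (edgesIn_of_subset (subset_ladderEdges_succ hab ht).2.1),
    isTreeOn_iff hne' (edgesIn_of_subset ht), card_Icc_succ (by omega),
    Finset.card_insert_of_notMem fun h => zEdge_notMem (by omega) (ht h), Nat.add_right_cancel_iff]
  refine and_congr_left fun _ => ⟨fun h => ?_, fun h => ?_⟩
  · rw [Finset.insert_eq] at h
    refine h.contract b ht subset_rfl fun x y hxy => ?_
    have := (zEdge_eq_iff _ _ _).1 (Finset.mem_singleton.1 hxy).symm
    have e : (if x = b + 1 then b else x) = (if y = b + 1 then b else y) := by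
      split_ifs <;> omega
    rw [e]
  · refine h.extend b (by omega) (fun x y hxy => ?_) ?_
    · exact SimpleGraph.Adj.reachable ((SimpleGraph.fromEdgeSet_adj _).2
        ⟨Finset.mem_insert_of_mem hxy, (edgesIn_of_subset ht _ hxy).1⟩)
    · have := adj_zEdge (s := (insert (zEdge (b + 1)) t : Finset (Sym2 ℤ))) (m := b + 1)
        (Finset.mem_insert_self _ _)
      rwa [add_sub_cancel_right] at this

lemma isTreeOn_insert_hEdge (hab : a + 1 ≤ b) (ht : t ⊆ ladderEdges a b) :
    IsTreeOn (Finset.Icc a (b + 1)) (insert (hEdge 2 (b + 1)) t) ↔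
      IsTreeOn (Finset.Icc a b) t := by
  have hne : (Finset.Icc a (b + 1)).Nonempty := ⟨a, Finset.mem_Icc.2 (by omega)⟩
  have hne' : (Finset.Icc a b).Nonempty := ⟨a, Finset.mem_Icc.2 (by omega)⟩
  rw [isTreeOn_iff hne (edgesIn_of_subset (subset_ladderEdges_succ hab ht).2.2.1),
    isTreeOn_iff hne' (edgesIn_of_subset ht), card_Icc_succ (by omega),
    Finset.card_insert_of_notMem fun h => hEdge_notMem (by omega) (ht h), Nat.add_right_cancel_iff]
  refine and_congr_left fun _ => ⟨fun h => ?_, fun h => ?_⟩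
  · rw [Finset.insert_eq] at h
    refine h.contract (b - 1) ht subset_rfl fun x y hxy => ?_
    have := (hEdge_eq_iff _ _ _).1 (Finset.mem_singleton.1 hxy).symm
    have e : (if x = b + 1 then b - 1 else x) = (if y = b + 1 then b - 1 else y) := by
      split_ifs <;> omega
    rw [e]
  · refine h.extend (b - 1) (by omega) (fun x y hxy => ?_) ?_
    · exact SimpleGraph.Adj.reachable ((SimpleGraph.fromEdgeSet_adj _).2
        ⟨Finset.mem_insert_of_mem hxy, (edgesIn_of_subset ht _ hxy).1⟩)
    · have := adj_hEdge (s := (insert (hEdge 2 (b + 1)) t : Finset (Sym2 ℤ))) (m := b + 1)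
        (Finset.mem_insert_self _ _)
      rwa [show b + 1 - 2 = b - 1 by ring] at this

/-- The path b, b + 1, b - 1 connects the same points as the rung {b - 1, b}, and with that rung
already present it would close a triangle. -/
lemma isTreeOn_insert_both (hab : a + 1 ≤ b) (ht : t ⊆ ladderEdges a b) :
    IsTreeOn (Finset.Icc a (b + 1)) (insert (zEdge (b + 1)) (insert (hEdge 2 (b + 1)) t)) ↔
      zEdge b ∉ t ∧ IsTreeOn (Finset.Icc a b) (insert (zEdge b) t) := by
  have hne : (Finset.Icc a (b + 1)).Nonempty := ⟨a, Finset.mem_Icc.2 (by omega)⟩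
  have hne' : (Finset.Icc a b).Nonempty := ⟨a, Finset.mem_Icc.2 (by omega)⟩
  have hzt : insert (zEdge b) t ⊆ ladderEdges a b :=
    Finset.insert_subset (zEdge_mem hab le_rfl) ht
  have hz : zEdge (b + 1) ∉ insert (hEdge 2 (b + 1)) t := by
    rw [Finset.mem_insert, not_or]
    exact ⟨zEdge_ne_hEdge _ _, fun h => zEdge_notMem (by omega) (ht h)⟩
  have hh : hEdge 2 (b + 1) ∉ t := fun h => hEdge_notMem (by omega) (ht h)
  have hconn : ConnOn (Finset.Icc a (b + 1)) (insert (zEdge (b + 1)) (insert (hEdge 2 (b + 1)) t)) ↔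
      ConnOn (Finset.Icc a b) (insert (zEdge b) t) := by
    constructor
    · intro h
      have e : insert (zEdge (b + 1)) (insert (hEdge 2 (b + 1)) t) =
        {zEdge (b + 1), hEdge 2 (b + 1)} ∪ t := by grind
      rw [e] at h
      refine h.contract b ht (Finset.subset_insert _ _) fun x y hxy => ?_
      have hr := adj_zEdge (s := (insert (zEdge b) t : Finset (Sym2 ℤ))) (m := b)
        (Finset.mem_insert_self _ _)
      rw [Finset.mem_insert, Finset.mem_singleton] at hxy
      rcases hxy with hxy | hxy
      · have := (zEdge_eq_iff _ _ _).1 hxy.symm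
        have e : (if x = b + 1 then b else x) = (if y = b + 1 then b else y) := by
          split_ifs <;> omega
        rw [e]
      · rcases (hEdge_eq_iff _ _ _).1 hxy.symm with ⟨h1, h2⟩ | ⟨h1, h2⟩
        · rw [if_neg (by omega), if_pos h2, h1, show b + 1 - 2 = b - 1 by ring]
          exact hr
        · rw [if_pos h1, if_neg (by omega), h2, show b + 1 - 2 = b - 1 by ring]
          exact hr.symm
    · intro h
      have h1 := adj_zEdge
        (s := (insert (zEdge (b + 1)) (insert (hEdge 2 (b + 1)) t) : Finset (Sym2 ℤ))) (m := b + 1)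
        (Finset.mem_insert_self _ _)
      have h2 := adj_hEdge
        (s := (insert (zEdge (b + 1)) (insert (hEdge 2 (b + 1)) t) : Finset (Sym2 ℤ))) (m := b + 1)
        (Finset.mem_insert_of_mem (Finset.mem_insert_self _ _))
      rw [add_sub_cancel_right] at h1
      rw [show b + 1 - 2 = b - 1 by ring] at h2
      refine h.extend b (by omega) (fun x y hxy => ?_) h1
      rcases Finset.mem_insert.1 hxy with hxy | hxy
      · rcases (zEdge_eq_iff _ _ _).1 hxy.symm with ⟨rfl, rfl⟩ | ⟨rfl, rfl⟩
        · exact h2.trans h1.symm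
        · exact h1.trans h2.symm
      · exact SimpleGraph.Adj.reachable ((SimpleGraph.fromEdgeSet_adj _).2
          ⟨Finset.mem_insert_of_mem (Finset.mem_insert_of_mem hxy),
            (edgesIn_of_subset ht _ hxy).1⟩)
  rw [isTreeOn_iff hne (edgesIn_of_subset (subset_ladderEdges_succ hab ht).2.2.2),
    isTreeOn_iff hne' (edgesIn_of_subset hzt), card_Icc_succ (by omega),
    Finset.card_insert_of_notMem hz, Finset.card_insert_of_notMem hh, hconn]
  -- If the rung is already in `t`, connectedness of `t` provides enough edges for [a, b], and the
  -- two new ones are one too many for a tree on [a, b + 1].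
  by_cases hzb : zEdge b ∈ t
  · simp only [hzb, not_true_eq_false, false_and, iff_false, not_and]
    intro h
    have := h.card_le hne' (edgesIn_of_subset hzt)
    rw [Finset.insert_eq_of_mem hzb] at this
    omega
  · rw [Finset.card_insert_of_notMem hzb, Nat.add_right_cancel_iff]
    simp [hzb]

lemma isTreeOn_start (a : ℤ) : IsTreeOn (Finset.Icc a (a + 1)) {zEdge (a + 1)} ∧
    ¬ IsTreeOn (Finset.Icc a (a + 1)) ∅ := by
  have hne : (Finset.Icc a (a + 1)).Nonempty := ⟨a, Finset.mem_Icc.2 (by omega)⟩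
  have hc : (Finset.Icc a (a + 1)).card = 2 := by rw [Int.card_Icc]; omega
  rw [isTreeOn_iff hne (edgesIn_of_subset (ladderEdges_start a).ge),
    isTreeOn_iff hne (edgesIn_of_subset (Finset.empty_subset _)), hc]
  refine ⟨⟨?_, by simp⟩, by simp⟩
  have h := adj_zEdge (s := (({zEdge (a + 1)} : Finset (Sym2 ℤ)) : Set (Sym2 ℤ))) (m := a + 1)
    (by simp)
  rw [add_sub_cancel_right] at h
  intro x hx y hy
  rw [Finset.mem_Icc] at hx hy
  have h1 : ∀ z, a ≤ z ∧ z ≤ a + 1 → (SimpleGraph.fromEdgeSet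
      (({zEdge (a + 1)} : Finset (Sym2 ℤ)) : Set (Sym2 ℤ))).Reachable a z := by
    intro z hz
    rcases (show z = a ∨ z = a + 1 by omega) with rfl | rfl
    · exact SimpleGraph.Reachable.refl _
    · exact h
  exact (h1 x hx).symm.trans (h1 y hy)

end Recursion

/-! ### The transfer recursion for weighted sums over spanning trees -/

/-- The weight of the configuration `t` on the edge set `E`, for edge weights depending on the
presence of the edge. -/
def configWeight (g : Sym2 ℤ → Bool → ℝ) (E t : Finset (Sym2 ℤ)) : ℝ :=
  ∏ e ∈ E, g e (edgeIndicator t e)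

open Classical in
/-- The sum of the weights of the spanning trees of `[a, b]`. -/
def treeSum (g : Sym2 ℤ → Bool → ℝ) (a b : ℤ) : ℝ :=
  ∑ t ∈ (ladderEdges a b).powerset,
    if IsTreeOn (Finset.Icc a b) t then configWeight g (ladderEdges a b) t else 0

open Classical in
/-- The sum of the weights of the configurations which become spanning trees of `[a, b]` after
the addition of the last rung. -/
def splitSum (g : Sym2 ℤ → Bool → ℝ) (a b : ℤ) : ℝ :=
  ∑ t ∈ (ladderEdges a b).powerset,
    if zEdge b ∉ t ∧ IsTreeOn (Finset.Icc a b) (insert (zEdge b) t)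
      then configWeight g (ladderEdges a b) t else 0

lemma edgeIndicator_of_mem {V : Type*} {t : Finset (Sym2 V)} {e : Sym2 V} (h : e ∈ t) :
    edgeIndicator t e = true := by simp [edgeIndicator, h]

lemma edgeIndicator_of_notMem {V : Type*} {t : Finset (Sym2 V)} {e : Sym2 V} (h : e ∉ t) :
    edgeIndicator t e = false := by simp [edgeIndicator, h]

lemma configWeight_congr (g : Sym2 ℤ → Bool → ℝ) {E t t' : Finset (Sym2 ℤ)}
    (h : ∀ e ∈ E, (e ∈ t ↔ e ∈ t')) : configWeight g E t = configWeight g E t' := by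
  refine Finset.prod_congr rfl fun e he => ?_
  have : edgeIndicator t e = edgeIndicator t' e := by simp [edgeIndicator, h e he]
  rw [this]

lemma sum_powerset_ladderEdges_succ {a b : ℤ} (hab : a + 1 ≤ b) (φ : Finset (Sym2 ℤ) → ℝ) :
    ∑ t ∈ (ladderEdges a (b + 1)).powerset, φ t =
      ∑ t ∈ (ladderEdges a b).powerset, (φ t + φ (insert (hEdge 2 (b + 1)) t) +
        (φ (insert (zEdge (b + 1)) t) +
          φ (insert (zEdge (b + 1)) (insert (hEdge 2 (b + 1)) t)))) := by
  have hh := hEdge_notMem (a := a) (b := b) (m := b + 1) (by omega)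
  have hz : zEdge (b + 1) ∉ insert (hEdge 2 (b + 1)) (ladderEdges a b) := by
    rw [Finset.mem_insert, not_or]
    exact ⟨zEdge_ne_hEdge _ _, zEdge_notMem (by omega)⟩
  rw [ladderEdges_succ hab, Finset.sum_powerset_insert hz, Finset.sum_powerset_insert hh,
    Finset.sum_powerset_insert hh]
  simp only [Finset.sum_add_distrib]

section

variable {a b : ℤ} {t : Finset (Sym2 ℤ)} (g : Sym2 ℤ → Bool → ℝ)

lemma configWeight_succ (hab : a + 1 ≤ b) (s : Finset (Sym2 ℤ)) :
    configWeight g (ladderEdges a (b + 1)) s =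
      g (zEdge (b + 1)) (edgeIndicator s (zEdge (b + 1))) *
      (g (hEdge 2 (b + 1)) (edgeIndicator s (hEdge 2 (b + 1))) *
        configWeight g (ladderEdges a b) s) := by
  have hh := hEdge_notMem (a := a) (b := b) (m := b + 1) (by omega)
  have hz : zEdge (b + 1) ∉ insert (hEdge 2 (b + 1)) (ladderEdges a b) := by
    rw [Finset.mem_insert, not_or]
    exact ⟨zEdge_ne_hEdge _ _, zEdge_notMem (by omega)⟩
  unfold configWeight
  rw [ladderEdges_succ hab, Finset.prod_insert hz, Finset.prod_insert hh]

lemma configWeight_succ_none (hab : a + 1 ≤ b) (ht : t ⊆ ladderEdges a b) :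
    configWeight g (ladderEdges a (b + 1)) t = g (zEdge (b + 1)) false *
      (g (hEdge 2 (b + 1)) false * configWeight g (ladderEdges a b) t) := by
  rw [configWeight_succ g hab,
    edgeIndicator_of_notMem fun h => zEdge_notMem (by omega) (ht h),
    edgeIndicator_of_notMem fun h => hEdge_notMem (by omega) (ht h)]

lemma configWeight_succ_hEdge (hab : a + 1 ≤ b) (ht : t ⊆ ladderEdges a b) :
    configWeight g (ladderEdges a (b + 1)) (insert (hEdge 2 (b + 1)) t) =
      g (zEdge (b + 1)) false *
      (g (hEdge 2 (b + 1)) true * configWeight g (ladderEdges a b) t) := by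
  rw [configWeight_succ g hab, edgeIndicator_of_mem (Finset.mem_insert_self _ _),
    edgeIndicator_of_notMem]
  · congr 2
    refine configWeight_congr g fun e he => ?_
    have : e ≠ hEdge 2 (b + 1) := fun h => hEdge_notMem (by omega) (h ▸ he)
    simp [this]
  · rw [Finset.mem_insert, not_or]
    exact ⟨zEdge_ne_hEdge _ _, fun h => zEdge_notMem (by omega) (ht h)⟩

lemma configWeight_succ_zEdge (hab : a + 1 ≤ b) (ht : t ⊆ ladderEdges a b) :
    configWeight g (ladderEdges a (b + 1)) (insert (zEdge (b + 1)) t) =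
      g (zEdge (b + 1)) true *
      (g (hEdge 2 (b + 1)) false * configWeight g (ladderEdges a b) t) := by
  rw [configWeight_succ g hab, edgeIndicator_of_mem (Finset.mem_insert_self _ _),
    edgeIndicator_of_notMem]
  · congr 2
    refine configWeight_congr g fun e he => ?_
    have : e ≠ zEdge (b + 1) := fun h => zEdge_notMem (by omega) (h ▸ he)
    simp [this]
  · rw [Finset.mem_insert, not_or]
    exact ⟨(zEdge_ne_hEdge _ _).symm, fun h => hEdge_notMem (by omega) (ht h)⟩

lemma configWeight_succ_both (hab : a + 1 ≤ b) :
    configWeight g (ladderEdges a (b + 1)) (insert (zEdge (b + 1)) (insert (hEdge 2 (b + 1)) t)) =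
      g (zEdge (b + 1)) true *
      (g (hEdge 2 (b + 1)) true * configWeight g (ladderEdges a b) t) := by
  rw [configWeight_succ g hab, edgeIndicator_of_mem (Finset.mem_insert_self _ _),
    edgeIndicator_of_mem (Finset.mem_insert_of_mem (Finset.mem_insert_self _ _))]
  congr 2
  refine configWeight_congr g fun e he => ?_
  have h1 : e ≠ zEdge (b + 1) := fun h => zEdge_notMem (by omega) (h ▸ he)
  have h2 : e ≠ hEdge 2 (b + 1) := fun h => hEdge_notMem (by omega) (h ▸ he)
  simp [h1, h2]

/-- Sum over the edges chosen at the vertex b + 1: none gives no tree, exactly one makes it a leaf,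
and both play the role of the missing rung at b. -/
lemma treeSum_succ (hab : a + 1 ≤ b) :
    treeSum g a (b + 1) =
      (g (zEdge (b + 1)) true * g (hEdge 2 (b + 1)) false +
        g (zEdge (b + 1)) false * g (hEdge 2 (b + 1)) true) * treeSum g a b +
      g (zEdge (b + 1)) true * g (hEdge 2 (b + 1)) true * splitSum g a b := by
  classical
  unfold treeSum splitSum
  rw [sum_powerset_ladderEdges_succ hab, Finset.mul_sum, Finset.mul_sum, ← Finset.sum_add_distrib]
  refine Finset.sum_congr rfl fun t ht => ?_
  rw [Finset.mem_powerset] at ht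
  rw [if_neg (not_isTreeOn_succ hab ht)]
  simp only [isTreeOn_insert_zEdge hab ht, isTreeOn_insert_hEdge hab ht,
    isTreeOn_insert_both hab ht, configWeight_succ_hEdge g hab ht, configWeight_succ_zEdge g hab ht,
    configWeight_succ_both g hab]
  split_ifs <;> ring

/-- The rung at b + 1 is absent but counted as added: without the h-edge it makes b + 1 a leaf, with
the h-edge the two replace the rung at b. -/
lemma splitSum_succ (hab : a + 1 ≤ b) :
    splitSum g a (b + 1) =
      g (zEdge (b + 1)) false * g (hEdge 2 (b + 1)) false * treeSum g a b +
      g (zEdge (b + 1)) false * g (hEdge 2 (b + 1)) true * splitSum g a b := by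
  classical
  unfold treeSum splitSum
  rw [sum_powerset_ladderEdges_succ hab, Finset.mul_sum, Finset.mul_sum, ← Finset.sum_add_distrib]
  refine Finset.sum_congr rfl fun t ht => ?_
  rw [Finset.mem_powerset] at ht
  have h1 : zEdge (b + 1) ∉ t := fun h => zEdge_notMem (by omega) (ht h)
  have h2 : zEdge (b + 1) ∉ insert (hEdge 2 (b + 1)) t := by
    rw [Finset.mem_insert, not_or]
    exact ⟨zEdge_ne_hEdge _ _, h1⟩
  simp only [h1, h2, Finset.mem_insert_self, not_true_eq_false, not_false_eq_true, true_and,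
    false_and, if_false, isTreeOn_insert_zEdge hab ht, 
    isTreeOn_insert_both hab ht, configWeight_succ_hEdge g hab ht, configWeight_succ_none g hab ht]
  split_ifs <;> ring

lemma treeSum_start (a : ℤ) : treeSum g a (a + 1) = g (zEdge (a + 1)) true := by
  classical
  unfold treeSum
  rw [ladderEdges_start, ← insert_empty_eq, Finset.sum_powerset_insert (by simp)]
  simp [(isTreeOn_start a).1, (isTreeOn_start a).2, configWeight, edgeIndicator]

lemma splitSum_start (a : ℤ) : splitSum g a (a + 1) = g (zEdge (a + 1)) false := by
  classical
  unfold splitSum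
  rw [ladderEdges_start, ← insert_empty_eq, Finset.sum_powerset_insert (by simp)]
  simp [(isTreeOn_start a).1, configWeight, edgeIndicator]

end

/-! ### Transfer maps -/

/-- The composition of the site maps `σ (a + 1), …, σ (a + j)`. -/
def iterSites {W : Type*} (σ : ℤ → W → W) (a : ℤ) : ℕ → W → W
  | 0, v => v
  | j + 1, v => σ (a + j + 1) (iterSites σ a j v)

lemma iterSites_add {W : Type*} (σ : ℤ → W → W) (a : ℤ) (i j : ℕ) (v : W) :
    iterSites σ a (i + j) v = iterSites σ (a + i) j (iterSites σ a i v) := by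
  induction j with
  | zero => rfl
  | succ j ih =>
    rw [← add_assoc, iterSites, iterSites, ih]
    congr 1
    push_cast; ring

lemma iterSites_congr {W : Type*} {σ τ : ℤ → W → W} {a : ℤ} {j : ℕ}
    (h : ∀ m, a < m → m ≤ a + j → σ m = τ m) (v : W) : iterSites σ a j v = iterSites τ a j v := by
  induction j with
  | zero => rfl
  | succ j ih =>
    rw [iterSites, iterSites, ih fun m h1 h2 => h m h1 (by push_cast; omega),
      h (a + j + 1) (by omega) (by push_cast; omega)]

lemma iterSites_eq_iterate {W : Type*} {σ : ℤ → W → W} {A : W → W} {a : ℤ} {j : ℕ}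
    (h : ∀ m, a < m → m ≤ a + j → σ m = A) (v : W) : iterSites σ a j v = A^[j] v := by
  rw [iterSites_congr (τ := fun _ => A) h]
  clear h
  induction j with
  | zero => rfl
  | succ j ih => rw [iterSites, ih, Function.iterate_succ_apply']

lemma continuous_iterSites {W : Type*} [TopologicalSpace W] {σ : ℤ → W → W}
    (h : ∀ m, Continuous (σ m)) (a : ℤ) (j : ℕ) : Continuous (iterSites σ a j) := by
  induction j with
  | zero => exact continuous_id
  | succ j ih => exact (h _).comp ih

/-- The transfer map of the site `m`, normalized by `α`. -/
def siteMap (α : ℝ) (g : Sym2 ℤ → Bool → ℝ) (m : ℤ) (v : ℝ × ℝ) : ℝ × ℝ :=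
  (α * ((g (zEdge m) true * g (hEdge 2 m) false + g (zEdge m) false * g (hEdge 2 m) true) * v.1 +
      g (zEdge m) true * g (hEdge 2 m) true * v.2),
    α * (g (zEdge m) false * g (hEdge 2 m) false * v.1 +
      g (zEdge m) false * g (hEdge 2 m) true * v.2))

lemma continuous_siteMap (α : ℝ) (g : Sym2 ℤ → Bool → ℝ) (m : ℤ) : Continuous (siteMap α g m) := by
  unfold siteMap; fun_prop

/-- The vector (0, 1) encodes the single vertex a. At the site a + 1 the edge `hEdge 2 (a + 1)`
leaves the interval; pretending that it is present with weight 1 yields the correct sums on [a, a +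
1]. -/
lemma treeSum_eq_iterSites (α : ℝ) (g : Sym2 ℤ → Bool → ℝ) (a : ℤ)
    (ha : g (hEdge 2 (a + 1)) true = 1) (j : ℕ) :
    (α ^ (j + 1) * treeSum g a (a + j + 1), α ^ (j + 1) * splitSum g a (a + j + 1)) =
      iterSites (siteMap α g) a (j + 1) (0, 1) := by
  induction j with
  | zero =>
    simp [iterSites, siteMap, treeSum_start, splitSum_start, ha]
  | succ j ih =>
    have e : a + ((j + 1 : ℕ) : ℤ) = a + j + 1 := by push_cast; ring
    rw [iterSites, ← ih, e, treeSum_succ g (b := a + j + 1) (by omega),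
      splitSum_succ g (b := a + j + 1) (by omega)]
    unfold siteMap
    ext <;> simp only <;> ring

/-- The transfer map of a site without constraint. -/
def freeMap (α : ℝ) (v : ℝ × ℝ) : ℝ × ℝ :=
  ((1 - α + α ^ 2) * v.1 + (1 - α) ^ 2 * v.2, α * v.1 + α * v.2)

/-- The invariant linear functional of the free transfer map. -/
def weightFun (α : ℝ) (v : ℝ × ℝ) : ℝ := v.1 + (1 - α) * v.2

/-- The other eigenfunctional of the free transfer map. -/
def decayFun (α : ℝ) (v : ℝ × ℝ) : ℝ := (1 - α) * v.2 - α * v.1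

/-- The normalized free matrix has eigenvalues 1 and α², with left eigenvectors (1, 1 - α) and (-α,
1 - α). These are `weightFun` and `decayFun`, and they diagonalize all free iterates. -/
lemma weightFun_iterate (α : ℝ) (k : ℕ) (v : ℝ × ℝ) :
    weightFun α ((freeMap α)^[k] v) = weightFun α v := by
  induction k with
  | zero => rfl
  | succ k ih =>
    rw [Function.iterate_succ_apply', ← ih]
    unfold weightFun freeMap
    ring

lemma decayFun_iterate (α : ℝ) (k : ℕ) (v : ℝ × ℝ) :
    decayFun α ((freeMap α)^[k] v) = α ^ (2 * k) * decayFun α v := by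
  induction k with
  | zero => simp
  | succ k ih =>
    rw [Function.iterate_succ_apply', mul_add, pow_add, mul_right_comm, ← ih]
    unfold decayFun freeMap
    ring

lemma fst_eq {α : ℝ} (h0 : 0 < α) (v : ℝ × ℝ) :
    v.1 = (weightFun α v - decayFun α v) / (1 + α) := by
  unfold weightFun decayFun
  field_simp
  ring

lemma snd_eq {α : ℝ} (h0 : 0 < α) (h1 : α < 1) (v : ℝ × ℝ) :
    v.2 = (α * weightFun α v + decayFun α v) / ((1 - α) * (1 + α)) := by
  have : 1 - α ≠ 0 := by linarith
  unfold weightFun decayFun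
  field_simp
  ring

/-- The stationary vector of the free transfer map. -/
def statVec (α : ℝ) : ℝ × ℝ := ((1 - α) / (1 + α), α / (1 + α))

lemma freeMap_statVec (α : ℝ) (h0 : 0 < α) : freeMap α (statVec α) = statVec α := by
  unfold freeMap statVec
  ext <;> simp only <;> field_simp <;> ring

lemma iterate_freeMap_statVec (α : ℝ) (h0 : 0 < α) (k : ℕ) :
    (freeMap α)^[k] (statVec α) = statVec α := by
  induction k with
  | zero => rfl
  | succ k ih => rw [Function.iterate_succ_apply', ih, freeMap_statVec α h0]

lemma weightFun_statVec (α : ℝ) (h0 : 0 < α) : weightFun α (statVec α) = 1 - α := by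
  unfold weightFun statVec
  field_simp

lemma tendsto_pow_two_mul {α : ℝ} (h0 : 0 < α) (h1 : α < 1) :
    Tendsto (fun k : ℕ => α ^ (2 * k)) atTop (𝓝 0) := by
  simp only [pow_mul]
  exact tendsto_pow_atTop_nhds_zero_of_lt_one (by positivity) (by nlinarith)

lemma tendsto_iterate_start {α : ℝ} (h0 : 0 < α) (h1 : α < 1) :
    Tendsto (fun k => (freeMap α)^[k] ((0, 1) : ℝ × ℝ)) atTop (𝓝 (statVec α)) := by
  have hp := tendsto_pow_two_mul h0 h1
  have h : ∀ k, (freeMap α)^[k] ((0, 1) : ℝ × ℝ) =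
      (((1 - α) - α ^ (2 * k) * (1 - α)) / (1 + α),
        (α * (1 - α) + α ^ (2 * k) * (1 - α)) / ((1 - α) * (1 + α))) := by
    intro k
    ext
    · rw [fst_eq h0 ((freeMap α)^[k] _), weightFun_iterate, decayFun_iterate]
      simp [weightFun, decayFun]
    · rw [snd_eq h0 h1 ((freeMap α)^[k] _), weightFun_iterate, decayFun_iterate]
      simp [weightFun, decayFun]
  simp only [h]
  have hα : 1 - α ≠ 0 := by linarith
  have e : statVec α = (((1 - α) - 0 * (1 - α)) / (1 + α),
        (α * (1 - α) + 0 * (1 - α)) / ((1 - α) * (1 + α))) := by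
    unfold statVec
    ext
    · simp
    · simp only; field_simp; ring
  rw [e]
  exact ((tendsto_const_nhds.sub (hp.mul_const _)).div_const _).prodMk_nhds
    ((tendsto_const_nhds.add (hp.mul_const _)).div_const _)

lemma tendsto_fst_iterate {α : ℝ} (h0 : 0 < α) (h1 : α < 1) {v : ℕ → ℝ × ℝ} {w : ℝ × ℝ}
    (hv : Tendsto v atTop (𝓝 w)) :
    Tendsto (fun k => ((freeMap α)^[k] (v k)).1) atTop (𝓝 (weightFun α w / (1 + α))) := by
  have hw : Continuous (weightFun α) := by unfold weightFun; fun_prop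
  have hd : Continuous (decayFun α) := by unfold decayFun; fun_prop
  have h := (((hw.tendsto w).comp hv).sub
    ((tendsto_pow_two_mul h0 h1).mul ((hd.tendsto w).comp hv))).div_const (1 + α)
  rw [zero_mul, sub_zero] at h
  refine h.congr fun k => ?_
  rw [fst_eq h0 ((freeMap α)^[k] _), weightFun_iterate, decayFun_iterate]
  rfl

/-! ### Edge weights with constraints -/

open Classical in
/-- The edge weights of the spanning tree measure, restricted to the configurations which agree
with `η` on `F`. -/
def constrainedWeight (c : ℝ) (F : Finset (Sym2 ℤ)) (η : Sym2 ℤ → Bool) (e : Sym2 ℤ) (b : Bool) :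
    ℝ :=
  if e ∈ F ∧ b ≠ η e then 0 else if b = true then zWeight c e else 1

lemma zWeight_zEdge (c : ℝ) (m : ℤ) : zWeight c (zEdge m) = c := by
  simp [zWeight]

lemma zWeight_hEdge (c : ℝ) (m : ℤ) : zWeight c (hEdge 2 m) = 1 := by
  unfold zWeight
  rw [if_neg]
  rintro ⟨k, hk⟩
  exact zEdge_ne_hEdge _ _ hk

lemma zWeight_pos {c : ℝ} (hc : 0 < c) (e : Sym2 ℤ) : 0 < zWeight c e := by
  unfold zWeight; split_ifs <;> positivity

lemma siteMap_free {α : ℝ} (h0 : 0 < α) {F : Finset (Sym2 ℤ)} {η : Sym2 ℤ → Bool} {m : ℤ}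
    (hz : zEdge m ∉ F) (hh : hEdge 2 m ∉ F) :
    siteMap α (constrainedWeight (rungWeight α) F η) m = freeMap α := by
  ext v
  all_goals
    simp only [siteMap, freeMap, constrainedWeight, hz, hh, false_and, if_false, zWeight_zEdge,
      zWeight_hEdge, rungWeight, if_true, Bool.false_eq_true]
    field_simp
    try ring

/-- All constraints sit at sites in (-K, K], so enlarging the interval only adds free sites on
either side of a fixed map. -/
lemma iterSites_constrained {α : ℝ} (h0 : 0 < α) {F : Finset (Sym2 ℤ)} {η : Sym2 ℤ → Bool} {K : ℕ}
    (hK : ∀ m : ℤ, (zEdge m ∈ F ∨ hEdge 2 m ∈ F) → -K < m ∧ m ≤ K) (k : ℕ) (v : ℝ × ℝ) :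
    iterSites (siteMap α (constrainedWeight (rungWeight α) F η)) (-((K + k : ℕ) : ℤ))
      (k + (2 * K + k)) v =
    (freeMap α)^[k] (iterSites (siteMap α (constrainedWeight (rungWeight α) F η)) (-K) (2 * K)
      ((freeMap α)^[k] v)) := by
  have e1 : -((K + k : ℕ) : ℤ) + k = -K := by push_cast; ring
  have e2 : -(K : ℤ) + (2 * K : ℕ) = K := by push_cast; ring
  rw [iterSites_add, iterSites_add, e1, e2, iterSites_eq_iterate (A := freeMap α),
    iterSites_eq_iterate (a := -((K + k : ℕ) : ℤ)) (A := freeMap α)]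
  · intro m h1 h2
    refine siteMap_free h0 ?_ ?_ <;> intro h <;> have := hK m (by simp [h]) <;> push_cast at * <;>
      omega
  · intro m h1 h2
    refine siteMap_free h0 ?_ ?_ <;> intro h <;> have := hK m (by simp [h]) <;> omega

lemma tendsto_treeSum {α : ℝ} (h0 : 0 < α) (h1 : α < 1) {F : Finset (Sym2 ℤ)}
    {η : Sym2 ℤ → Bool} {K : ℕ}
    (hK : ∀ m : ℤ, (zEdge m ∈ F ∨ hEdge 2 m ∈ F) → -K < m ∧ m ≤ K) :
    Tendsto (fun n : ℕ => α ^ (2 * n) *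
        treeSum (constrainedWeight (rungWeight α) F η) (-(n : ℤ)) n) atTop
      (𝓝 (weightFun α (iterSites (siteMap α (constrainedWeight (rungWeight α) F η)) (-K) (2 * K)
        (statVec α)) / (1 + α))) := by
  rw [← tendsto_add_atTop_iff_nat K]
  have hc := continuous_iterSites (continuous_siteMap α (constrainedWeight (rungWeight α) F η))
    (-K) (2 * K)
  have h := tendsto_fst_iterate h0 h1 ((hc.tendsto _).comp (tendsto_iterate_start h0 h1))
  refine h.congr' ?_
  -- With k ≥ 1 the first site lies outside the window, so its fictitious h-edge is unconstrained;
  -- it also makes the subtraction in the site count exact.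
  filter_upwards [eventually_ge_atTop 1] with k hk
  have hs := iterSites_constrained (η := η) h0 hK k (0, 1)
  have hg : constrainedWeight (rungWeight α) F η (hEdge 2 (-((K + k : ℕ) : ℤ) + 1)) true = 1 := by
    have : hEdge 2 (-((K + k : ℕ) : ℤ) + 1) ∉ F := by
      intro h
      have := hK _ (Or.inr h)
      push_cast at this
      omega
    unfold constrainedWeight
    rw [if_neg (by simp only [this, false_and, not_false_eq_true]), if_pos rfl, zWeight_hEdge]
  have ht := treeSum_eq_iterSites α (constrainedWeight (rungWeight α) F η) (-((K + k : ℕ) : ℤ)) hg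
    (k + (2 * K + k) - 1)
  rw [show k + (2 * K + k) - 1 + 1 = k + (2 * K + k) by omega, hs] at ht
  have ht1 := congrArg Prod.fst ht
  simp only at ht1
  rw [Function.comp_apply, ← ht1, add_comm k K]
  congr 2
  · ring
  · omega

/-! ### Cylinder probabilities of the finite measures and their limit. -/

lemma configWeight_constrained (c : ℝ) (F : Finset (Sym2 ℤ)) (η : Sym2 ℤ → Bool)
    {E t : Finset (Sym2 ℤ)} (ht : t ⊆ E) (h : ∀ e ∈ F, edgeIndicator t e = η e) :
    configWeight (constrainedWeight c F η) E t = treeWeight (zWeight c) t := by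
  classical
  unfold configWeight treeWeight
  rw [← Finset.prod_subset ht (f := fun e => constrainedWeight c F η e (edgeIndicator t e))]
  · refine Finset.prod_congr rfl fun e he => ?_
    have h1 := edgeIndicator_of_mem he
    unfold constrainedWeight
    rw [if_neg, h1, if_pos rfl]
    rintro ⟨h2, h3⟩
    exact h3 (h e h2)
  · intro e _ he
    have h1 := edgeIndicator_of_notMem he
    unfold constrainedWeight
    rw [if_neg, h1, if_neg (by simp)]
    rintro ⟨h2, h3⟩
    exact h3 (h e h2)

lemma configWeight_constrained_eq_zero (c : ℝ) (F : Finset (Sym2 ℤ)) (η : Sym2 ℤ → Bool)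
    {E t : Finset (Sym2 ℤ)} {e : Sym2 ℤ} (he : e ∈ E) (heF : e ∈ F)
    (h : edgeIndicator t e ≠ η e) : configWeight (constrainedWeight c F η) E t = 0 :=
  Finset.prod_eq_zero he (by simp [constrainedWeight, heF, h])

lemma mem_spanningTrees {a b : ℤ} {t : Finset (Sym2 ℤ)} :
    t ∈ spanningTrees (helixGraph 2) (Finset.Icc a b) ↔
      t ⊆ ladderEdges a b ∧ IsTreeOn (Finset.Icc a b) t := by
  unfold spanningTrees
  refine (@Finset.mem_filter _ _ (_) _ _).trans ?_
  rw [Finset.mem_powerset]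
  rfl

open Classical in
lemma treeSum_eq_sum_spanningTrees (g : Sym2 ℤ → Bool → ℝ) (a b : ℤ) :
    treeSum g a b = ∑ t ∈ spanningTrees (helixGraph 2) (Finset.Icc a b),
      configWeight g (ladderEdges a b) t := by
  unfold treeSum
  rw [← Finset.sum_filter]
  refine Finset.sum_congr ?_ fun _ _ => rfl
  ext t
  rw [mem_spanningTrees, Finset.mem_filter, Finset.mem_powerset]

lemma totalWeight_eq_treeSum (c : ℝ) (η : Sym2 ℤ → Bool) (a b : ℤ) :
    totalWeight (helixGraph 2) (zWeight c) (Finset.Icc a b) =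
      treeSum (constrainedWeight c ∅ η) a b := by
  rw [treeSum_eq_sum_spanningTrees]
  unfold totalWeight
  refine Finset.sum_congr rfl fun t ht => ?_
  rw [configWeight_constrained c ∅ η (mem_spanningTrees.1 ht).1 (by simp)]

lemma measurableSet_cylinder {E : Type*} (F : Finset E) (η : E → Bool) :
    MeasurableSet {ω : E → Bool | ∀ e ∈ F, ω e = η e} := by
  have : {ω : E → Bool | ∀ e ∈ F, ω e = η e} = ⋂ e ∈ F, (fun ω : E → Bool => ω e) ⁻¹' {η e} := by
    ext; simp
  rw [this]
  exact Finset.measurableSet_biInter _ fun s _ => measurable_pi_apply s (measurableSet_singleton _)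

-- Zero weights enforce η on the edges of F inside the finite graph. The other edges of F are
-- invisible to `treeSum` and absent from every tree, so the leading indicator excludes any η that
-- demands one of them.
open Classical in
lemma zigzagFinite_cylinder {c : ℝ} (hc : 0 < c) (n : ℕ) (F : Finset (Sym2 ℤ))
    (η : Sym2 ℤ → Bool) :
    zigzagFinite c n {ω | ∀ e ∈ F, ω e = η e} =
      ENNReal.ofReal ((if ∀ e ∈ F, e ∉ ladderEdges (-(n : ℤ)) n → η e = false then 1 else 0) *
        (treeSum (constrainedWeight c F η) (-(n : ℤ)) n /
          treeSum (constrainedWeight c ∅ η) (-(n : ℤ)) n)) := by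
  have hw : ∀ t, 0 ≤ treeWeight (zWeight c) t := fun t =>
    Finset.prod_nonneg fun e _ => (zWeight_pos hc e).le
  have hW : 0 ≤ totalWeight (helixGraph 2) (zWeight c) (Finset.Icc (-(n : ℤ)) n) :=
    Finset.sum_nonneg fun t _ => hw t
  unfold zigzagFinite finiteTreeMeasure
  rw [Measure.finsetSum_apply, treeSum_eq_sum_spanningTrees, Finset.sum_div, Finset.mul_sum,
    ENNReal.ofReal_sum_of_nonneg]
  · refine Finset.sum_congr rfl fun t ht => ?_
    have htE := (mem_spanningTrees.1 ht).1
    rw [Measure.smul_apply, Measure.dirac_apply' _ (measurableSet_cylinder F η), smul_eq_mul,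
      ← totalWeight_eq_treeSum]
    by_cases h : ∀ e ∈ F, edgeIndicator t e = η e
    · rw [Set.indicator_of_mem (by exact h), configWeight_constrained c F η htE h, if_pos, one_mul]
      · simp
      · intro e he heE
        rw [← h e he, edgeIndicator_of_notMem fun h' => heE (htE h')]
    · rw [Set.indicator_of_notMem (by exact h), mul_zero]
      push Not at h
      obtain ⟨e, he, hne⟩ := h
      by_cases heE : e ∈ ladderEdges (-(n : ℤ)) n
      · rw [configWeight_constrained_eq_zero c F η heE he hne]; simp
      · rw [if_neg]
        · simp
        · intro h'
          apply hne
          rw [h' e he heE, edgeIndicator_of_notMem fun h' => heE (htE h')]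
  · intro t ht
    rw [← totalWeight_eq_treeSum]
    refine mul_nonneg (by split_ifs <;> norm_num) (div_nonneg (Finset.prod_nonneg fun e _ => ?_) hW)
    unfold constrainedWeight
    split_ifs
    · exact le_rfl
    · exact (zWeight_pos hc e).le
    · exact zero_le_one

lemma exists_bound (F : Finset (Sym2 ℤ)) :
    ∃ K : ℕ, ∀ m : ℤ, (zEdge m ∈ F ∨ hEdge 2 m ∈ F) → -K < m ∧ m ≤ K := by
  have hinj : Function.Injective (hEdge 2) := by
    intro m n h
    unfold hEdge at h
    rw [Sym2.eq_iff] at h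
    omega
  have hf : {m : ℤ | zEdge m ∈ F ∨ hEdge 2 m ∈ F}.Finite :=
    (F.finite_toSet.preimage zEdge_injective.injOn).union (F.finite_toSet.preimage hinj.injOn)
  obtain ⟨u, hu⟩ := hf.bddAbove
  obtain ⟨l, hl⟩ := hf.bddBelow
  refine ⟨u.natAbs + l.natAbs + 1, fun m hm => ?_⟩
  have h1 := hu hm
  have h2 := hl hm
  omega

open Classical in
/-- The cylinder probabilities of the finite spanning tree measures converge. -/
lemma tendsto_zigzagFinite {α : ℝ} (h0 : 0 < α) (h1 : α < 1) (F : Finset (Sym2 ℤ))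
    (η : Sym2 ℤ → Bool) {K : ℕ}
    (hK : ∀ m : ℤ, (zEdge m ∈ F ∨ hEdge 2 m ∈ F) → -K < m ∧ m ≤ K) :
    Tendsto (fun n => zigzagFinite (rungWeight α) n {ω | ∀ e ∈ F, ω e = η e}) atTop
      (𝓝 (ENNReal.ofReal
        ((if ∀ e ∈ F, (∀ n : ℕ, e ∉ ladderEdges (-(n : ℤ)) n) → η e = false then 1 else 0) *
        (weightFun α (iterSites (siteMap α (constrainedWeight (rungWeight α) F η)) (-K) (2 * K)
          (statVec α)) / (1 - α))))) := by
  have hc : 0 < rungWeight α := by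
    have : 0 < 1 - α := by linarith
    unfold rungWeight; positivity
  have hα : 1 - α ≠ 0 := by linarith
  simp only [zigzagFinite_cylinder hc]
  -- The indicator is eventually constant because the finite graphs exhaust the ladder. In the ratio
  -- of tree sums the factors α^(2n) and 1 + α cancel.
  refine (ENNReal.continuous_ofReal.tendsto _).comp (Tendsto.mul ?_ ?_)
  · have hmono : ∀ e, ∀ᶠ n : ℕ in atTop, (e ∉ ladderEdges (-(n : ℤ)) n ↔
        ∀ n : ℕ, e ∉ ladderEdges (-(n : ℤ)) n) := by
      intro e
      by_cases he : ∀ n : ℕ, e ∉ ladderEdges (-(n : ℤ)) n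
      · exact Eventually.of_forall fun n => ⟨fun _ => he, fun _ => he n⟩
      · have he' := he
        push Not at he'
        obtain ⟨N, hN⟩ := he'
        filter_upwards [eventually_ge_atTop N] with n hn
        refine ⟨fun h => absurd ?_ h, fun h => absurd h he⟩
        rcases mem_ladderEdges.1 hN with ⟨m, h1, h2, h3⟩ | ⟨m, h1, h2, h3⟩
        · exact mem_ladderEdges.2 (Or.inl ⟨m, by omega, by omega, h3⟩)
        · exact mem_ladderEdges.2 (Or.inr ⟨m, by omega, by omega, h3⟩)
    have hall : ∀ᶠ n : ℕ in atTop, ∀ e ∈ F, (e ∉ ladderEdges (-(n : ℤ)) n ↔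
        ∀ n : ℕ, e ∉ ladderEdges (-(n : ℤ)) n) :=
      (Filter.eventually_all_finset F).2 fun e _ => hmono e
    refine tendsto_const_nhds.congr' ?_
    filter_upwards [hall] with n hn
    refine if_congr (forall₂_congr fun e he => ?_) rfl rfl
    rw [hn e he]
  · have hnum := tendsto_treeSum (η := η) h0 h1 hK
    have hden := tendsto_treeSum (η := η) (F := ∅) (K := 0) h0 h1 (by simp)
    have e0 : weightFun α (iterSites (siteMap α (constrainedWeight (rungWeight α) ∅ η))
        (-((0 : ℕ) : ℤ)) (2 * 0) (statVec α)) = 1 - α := weightFun_statVec α h0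
    rw [e0] at hden
    have h := hnum.div hden (div_ne_zero hα (by linarith))
    rw [div_div_div_cancel_right₀ (by linarith)] at h
    refine h.congr fun n => ?_
    simp only [Pi.div_apply]
    rw [mul_div_mul_left _ _ (by positivity)]

/-- The total weight only has to be nonzero, and this is read off from the positive limit of the
normalized tree sums; hence the restriction to large n. -/
lemma zigzagFinite_isProbabilityMeasure {α : ℝ} (h0 : 0 < α) (h1 : α < 1) :
    ∀ᶠ n in atTop, IsProbabilityMeasure (zigzagFinite (rungWeight α) n) := by
  have hc : 0 < rungWeight α := by
    have : 0 < 1 - α := by linarith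
    unfold rungWeight; positivity
  have hden := tendsto_treeSum (η := fun _ => true) (F := ∅) (K := 0) h0 h1 (by simp)
  have e0 : weightFun α (iterSites (siteMap α (constrainedWeight (rungWeight α) ∅ fun _ => true))
      (-((0 : ℕ) : ℤ)) (2 * 0) (statVec α)) = 1 - α := weightFun_statVec α h0
  rw [e0] at hden
  have hpos : 0 < (1 - α) / (1 + α) := div_pos (by linarith) (by linarith)
  filter_upwards [hden.eventually (eventually_gt_nhds hpos)] with n hn
  have hne : treeSum (constrainedWeight (rungWeight α) ∅ fun _ => true) (-(n : ℤ)) n ≠ 0 := by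
    intro h
    rw [h, mul_zero] at hn
    exact lt_irrefl _ hn
  have h := zigzagFinite_cylinder hc n ∅ (fun _ => true)
  constructor
  simpa [hne] using h

lemma exists_limit_zigzagFinite {α : ℝ} (h0 : 0 < α) (h1 : α < 1) :
    ∃ P, IsLimitMeasure (zigzagFinite (rungWeight α)) P := by
  refine exists_isLimitMeasure _ (zigzagFinite_isProbabilityMeasure h0 h1) fun F η => ?_
  obtain ⟨K, hK⟩ := exists_bound F
  exact ⟨_, tendsto_zigzagFinite h0 h1 F η hK⟩

lemma isLimitMeasure_zigzagTree {α : ℝ} (h0 : 0 < α) (h1 : α < 1) :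
    IsLimitMeasure (zigzagFinite (rungWeight α)) (zigzagTree (rungWeight α)) := by
  have h := exists_limit_zigzagFinite h0 h1
  unfold zigzagTree
  rw [dif_pos h]
  exact h.choose_spec

/-- The relation between the rung weight and the decay rate. -/
lemma decayRate_iff {c α : ℝ} (hc : 0 < c) :
    α = 1 + c / 2 - Real.sqrt (4 * c + c ^ 2) / 2 ↔ 0 < α ∧ α < 1 ∧ c = (1 - α) ^ 2 / α := by
  have hs := Real.sqrt_nonneg (4 * c + c ^ 2)
  have hs2 := Real.sq_sqrt (show 0 ≤ 4 * c + c ^ 2 by positivity)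
  set s := Real.sqrt (4 * c + c ^ 2)
  constructor
  · intro h
    -- Both bounds come from s² = c² + 4c = (c + 2)² - 4; the first gives α > 0, the second α < 1.
    have h1 : s < 2 + c := by nlinarith
    have h2 : c < s := by nlinarith
    have hα : 0 < α := by linarith
    refine ⟨hα, by linarith, ?_⟩
    rw [eq_div_iff hα.ne', h]
    nlinarith
  · rintro ⟨h1, h2, h3⟩
    rw [eq_div_iff h1.ne'] at h3
    have h4 : s = 2 + c - 2 * α := by
      have h5 : 0 ≤ 2 + c - 2 * α := by linarith
      have : s ^ 2 = (2 + c - 2 * α) ^ 2 := by rw [hs2]; nlinarith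
      exact (pow_left_inj₀ hs h5 two_ne_zero).1 this
    linarith

/-! ### Processes with independent gaps are renewal processes -/

section Gaps

variable {μ : Measure (ℤ → Bool)} [IsProbabilityMeasure μ] {a : ℝ} {u : ℕ → ℝ}

lemma measurable_shift : Measurable (fun (x : ℤ → Bool) (m : ℤ) => x (m + 1)) :=
  measurable_pi_lambda _ fun m => measurable_pi_apply (m + 1)

lemma isStationary_of_hasGaps (h : HasGaps (fun S => μ.real (onesOn S)) a u) :
    IsStationary μ := by
  refine ⟨measurable_shift, ?_⟩
  have : IsProbabilityMeasure (μ.map (fun (x : ℤ → Bool) (m : ℤ) => x (m + 1))) :=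
    Measure.isProbabilityMeasure_map measurable_shift.aemeasurable
  refine ext_of_onesOn fun S => ?_
  rw [Measure.map_apply measurable_shift (measurableSet_onesOn S)]
  have e : (fun (x : ℤ → Bool) (m : ℤ) => x (m + 1)) ⁻¹' onesOn S = onesOn (S.image (· + 1)) := by
    ext x
    change (∀ s ∈ S, x (s + 1) = true) ↔ ∀ s ∈ S.image (· + 1), x s = true
    rw [Finset.forall_mem_image]
  rw [e, ← ENNReal.toReal_eq_toReal_iff' (measure_ne_top _ _) (measure_ne_top _ _)]
  exact (h.shift 1).unique h S

lemma isRegenerative_of_hasGaps (h : HasGaps (fun S => μ.real (onesOn S)) a u) :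
    IsRegenerative 1 μ := by
  refine isRegenerative_of_onesOn fun S T hS hT => ?_
  have hf := h.factor 0 S T hS hT
  rw [← ENNReal.toReal_eq_toReal_iff' (by finiteness) (by finiteness), ENNReal.toReal_mul,
    ENNReal.toReal_mul]
  change μ.real _ * μ.real _ = μ.real _ * μ.real _
  rw [← onesOn_union, ← onesOn_union, ← onesOn_union, show μ.real (onesOn {0}) = a from h.singleton 0,
    Finset.union_comm (S ∪ {0}) T, Finset.union_comm S {0}, Finset.union_comm {0} T,
    ← Finset.insert_eq]
  exact hf

lemma isRenewal_of_hasGaps (h : HasGaps (fun S => μ.real (onesOn S)) a u) : IsRenewal μ :=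
  ⟨isStationary_of_hasGaps h, isRegenerative_of_hasGaps h⟩

lemma eq_of_hasGaps {ν : Measure (ℤ → Bool)} [IsProbabilityMeasure ν]
    (h : HasGaps (fun S => μ.real (onesOn S)) a u) (h' : HasGaps (fun S => ν.real (onesOn S)) a u) :
    μ = ν := by
  refine ext_of_onesOn fun S => ?_
  rw [← ENNReal.toReal_eq_toReal_iff' (measure_ne_top _ _) (measure_ne_top _ _)]
  exact h.unique h' S

end Gaps

lemma onesOn_singleton {R : Type*} (s : R) : onesOn {s} = {x : R → Bool | x s = true} := by
  simp [onesOn]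

lemma onesOn_pair {R : Type*} [DecidableEq R] (s t : R) :
    onesOn {s, t} = {x : R → Bool | x s = true} ∩ {x | x t = true} := by
  ext x; simp [onesOn]

lemma measurableSet_one {R : Type*} (s : R) : MeasurableSet {x : R → Bool | x s = true} := by
  rw [← onesOn_singleton]; exact measurableSet_onesOn _

lemma IsStationary.measure_shift {μ : Measure (ℤ → Bool)} (h : IsStationary μ) (s : ℕ) {W : Set (ℤ → Bool)}
    (hW : MeasurableSet W) : μ.real {x | (fun m => x (m + s)) ∈ W} = μ.real W := by
  have h1 := h.iterate s
  have e : ∀ s : ℕ, (fun (x : ℤ → Bool) (m : ℤ) => x (m + 1))^[s] =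
      fun (x : ℤ → Bool) (m : ℤ) => x (m + s) := by
    intro s
    induction s with
    | zero => ext x; simp
    | succ s ih =>
      rw [Function.iterate_succ', ih]
      ext x m
      simp only [Function.comp_apply]
      congr 1
      push_cast; ring
  rw [e] at h1
  exact congrArg ENNReal.toReal (h1.measure_preimage hW.nullMeasurableSet)

/-! ### Gap probabilities of a renewal process. -/

section Renewal

variable {μ : Measure (ℤ → Bool)} [IsProbabilityMeasure μ]

/-- Given a one at time `s`, the past before `s` and the configuration at time `s + t` are
independent. -/
lemma IsRenewal.cylinder_mul (h : IsRenewal μ) (F : Finset ℤ) (η : ℤ → Bool) (s t : ℕ)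
    (hF : ∀ j ∈ F, j < s) (ht : 1 ≤ t) :
    μ.real ({x | ∀ j ∈ F, x j = η j} ∩ {x | x s = true} ∩ {x | x ((s : ℤ) + t) = true}) *
        μ.real {x | x 0 = true} =
      μ.real ({x | ∀ j ∈ F, x j = η j} ∩ {x | x s = true}) *
        μ.real ({x | x 0 = true} ∩ {x | x t = true}) := by
  set V : Set (ℤ → Bool) := {x | ∀ j ∈ F, x (j - s) = η j} with hV
  set Z : Set (ℤ → Bool) := {x | x 0 = true} with hZ
  set W : Set (ℤ → Bool) := {x | x t = true} with hW
  have hZm : MeasurableSet Z := measurableSet_one 0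
  have hWm : MeasurableSet W := measurableSet_one _
  let B : Set (Set.Iic (-((1 : ℕ) : ℤ)) → Bool) :=
    {y | ∀ j : F, y ⟨j - s, by have := hF j j.2; simp only [Set.mem_Iic]; push_cast; omega⟩ = η j}
  let C : Set (Set.Ici (1 : ℤ) → Bool) :=
    {y | y ⟨t, by simp only [Set.mem_Ici]; exact_mod_cast ht⟩ = true}
  have hB : MeasurableSet B := by
    have : B = ⋂ j : F, (fun y : Set.Iic (-((1 : ℕ) : ℤ)) → Bool => y ⟨j - s, by
        have := hF j j.2; simp only [Set.mem_Iic]; push_cast; omega⟩) ⁻¹' {η j} := by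
      ext y; simp [B]
    rw [this]
    exact MeasurableSet.iInter fun j => measurable_pi_apply _ (measurableSet_singleton _)
  have hC : MeasurableSet C := measurableSet_one _
  have hBV : (Set.Iic (-((1 : ℕ) : ℤ))).domRestrict ⁻¹' B = V := by
    ext x; simp [B, V, Set.domRestrict]
  have hCW : (Set.Ici (1 : ℤ)).domRestrict ⁻¹' C = W := by
    ext x; simp [C, W, Set.domRestrict]
  have hVm : MeasurableSet V := hBV ▸ measurable_domRestrict _ hB
  -- Regeneration is formulated at the origin for conditioning events of positive probability. Null
  -- events are trivial, and stationarity carries the identity to s.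
  have key : μ.real (V ∩ Z ∩ W) * μ.real Z = μ.real (V ∩ Z) * μ.real (Z ∩ W) := by
    by_cases h0 : μ (V ∩ Z) = 0
    · have h1 : μ (V ∩ Z ∩ W) = 0 := measure_mono_null Set.inter_subset_left h0
      simp [Measure.real, h0, h1]
    · have hz : μ Z ≠ 0 := fun hz => h0 (measure_mono_null Set.inter_subset_right hz)
      have h2 := h.2 B C hB hC
      rw [hBV, hCW, onesEvent_one, onesOn_singleton] at h2
      have h3 := h2 h0
      rw [cond_apply (hVm.inter hZm), cond_apply hZm, ← ENNReal.div_eq_inv_mul,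
        ← ENNReal.div_eq_inv_mul, ENNReal.div_eq_div_iff hz (measure_ne_top _ _) h0
        (measure_ne_top _ _)] at h3
      have h4 := congrArg ENNReal.toReal h3
      rw [ENNReal.toReal_mul, ENNReal.toReal_mul] at h4
      change μ.real _ * μ.real _ = μ.real _ * μ.real _ at h4
      rw [mul_comm, h4]
  have e1 := h.1.measure_shift s ((hVm.inter hZm).inter hWm)
  have e2 := h.1.measure_shift s (hVm.inter hZm)
  have e3 : {x : ℤ → Bool | (fun m => x (m + s)) ∈ V ∩ Z ∩ W} =
      {x | ∀ j ∈ F, x j = η j} ∩ {x | x s = true} ∩ {x | x ((s : ℤ) + t) = true} := by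
    ext x; simp [V, Z, W, add_comm]
  have e4 : {x : ℤ → Bool | (fun m => x (m + s)) ∈ V ∩ Z} =
      {x | ∀ j ∈ F, x j = η j} ∩ {x | x s = true} := by
    ext x; simp [V, Z]
  rw [← e3, ← e4, e1, e2, key]

/-- The event that on `[b, n]` there is no one except at the origin. -/
def gapEvent (b n : ℤ) : Set (ℤ → Bool) := {x | ∀ j ∈ Finset.Icc b n, x j = decide (j = 0)}

/-- Two cases are used: b = 0 is a one at the origin followed by n zeros, b = 1 is just n zeros. The
bound on b makes n + 1 a constrained site. -/
lemma gapEvent_succ (b : ℤ) (n : ℕ) (hb : b ≤ 1) :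
    gapEvent b ((n + 1 : ℕ) : ℤ) = gapEvent b n \ {x | x ((n + 1 : ℕ) : ℤ) = true} := by
  ext x
  constructor
  · intro h
    refine ⟨fun j hj => h j ?_, ?_⟩
    · rw [Finset.mem_Icc] at *; push_cast; omega
    · have := h ((n + 1 : ℕ) : ℤ) (Finset.mem_Icc.2 (by push_cast; omega))
      rw [decide_eq_false (by push_cast; omega)] at this
      show ¬ (x ((n + 1 : ℕ) : ℤ) = true)
      rw [this]; simp
  · rintro ⟨h1, h2⟩ j hj
    rw [Finset.mem_Icc] at hj
    rcases hj.2.eq_or_lt with rfl | hlt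
    · rw [decide_eq_false (by push_cast; omega)]
      exact Bool.eq_false_iff.2 h2
    · exact h1 j (Finset.mem_Icc.2 (by push_cast at hlt; omega))

lemma measureReal_gapEvent_succ (b : ℤ) (n : ℕ) (hb : b ≤ 1) :
    μ.real (gapEvent b ((n + 1 : ℕ) : ℤ)) =
      μ.real (gapEvent b n) - μ.real (gapEvent b n ∩ {x | x ((n : ℤ) + (1 : ℕ)) = true}) := by
  rw [gapEvent_succ b n hb, ← measureReal_sdiff_add_inter (s := gapEvent b n)
    (measurableSet_one ((n + 1 : ℕ) : ℤ))]
  push_cast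
  ring

/-- Split according to the value at n + 1: a one there is a renewal, so the subtracted part
factorizes. -/
lemma IsRenewal.measureReal_gapEvent_inter (h : IsRenewal μ) (b : ℤ) (n t : ℕ) (hb : b ≤ 1)
    (ht : 1 ≤ t) (h0 : μ.real {x | x 0 = true} ≠ 0) :
    μ.real (gapEvent b ((n + 1 : ℕ) : ℤ) ∩ {x | x (((n + 1 : ℕ) : ℤ) + t) = true}) =
      μ.real (gapEvent b n ∩ {x | x ((n : ℤ) + (t + 1 : ℕ)) = true}) -
      μ.real (gapEvent b n ∩ {x | x ((n : ℤ) + (1 : ℕ)) = true}) *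
        (μ.real ({x | x 0 = true} ∩ {x | x t = true}) / μ.real {x | x 0 = true}) := by
  have h1 := h.cylinder_mul (Finset.Icc b n) (fun j => decide (j = 0)) (n + 1) t
    (fun j hj => by rw [Finset.mem_Icc] at hj; push_cast; omega) ht
  have e1 : (n : ℤ) + (t + 1 : ℕ) = ((n + 1 : ℕ) : ℤ) + t := by push_cast; ring
  have e2 : (n : ℤ) + (1 : ℕ) = ((n + 1 : ℕ) : ℤ) := by push_cast; ring
  have e3 : (gapEvent b n \ {x | x ((n + 1 : ℕ) : ℤ) = true}) ∩
      {x | x (((n + 1 : ℕ) : ℤ) + t) = true} =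
      (gapEvent b n ∩ {x | x (((n + 1 : ℕ) : ℤ) + t) = true}) \ {x | x ((n + 1 : ℕ) : ℤ) = true} := by
    ext x; simp only [Set.mem_inter_iff, Set.mem_sdiff]; tauto
  rw [e1, e2, gapEvent_succ b n hb, e3, mul_div_assoc', eq_sub_iff_add_eq,
    ← measureReal_sdiff_add_inter (s := gapEvent b n ∩ {x | x (((n + 1 : ℕ) : ℤ) + t) = true})
      (measurableSet_one ((n + 1 : ℕ) : ℤ)), Set.inter_right_comm]
  congr 1
  rw [div_eq_iff h0]
  exact h1.symm

/-- For a renewal process with geometric pair probabilities, the probabilities of the events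
`gapEvent b n` are given by a two dimensional linear recursion. -/
lemma IsRenewal.exists_gap_recursion (h : IsRenewal μ) {a q H₀ : ℝ} (b : ℤ) (hb : b ≤ 1)
    (ha : μ.real {x | x 0 = true} = a) (ha0 : a ≠ 0)
    (hu : ∀ t : ℕ, 1 ≤ t →
      μ.real ({x | x 0 = true} ∩ {x | x t = true}) = a * (a * (1 - q ^ t)))
    (h0 : ∀ t : ℕ, 1 ≤ t → μ.real (gapEvent b 0 ∩ {x | x t = true}) =
      a * (μ.real (gapEvent b 0) - q ^ t * H₀)) :
    ∃ H : ℕ → ℝ, H 0 = H₀ ∧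
      (∀ n : ℕ, μ.real (gapEvent b n ∩ {x | x ((n : ℤ) + (1 : ℕ)) = true}) =
        a * (μ.real (gapEvent b n) - q * H n)) ∧
      (∀ n : ℕ, μ.real (gapEvent b ((n + 1 : ℕ) : ℤ)) =
        μ.real (gapEvent b n) - a * (μ.real (gapEvent b n) - q * H n)) ∧
      ∀ n : ℕ, H (n + 1) = q * H n - a * (μ.real (gapEvent b n) - q * H n) := by
  let H : ℕ → ℝ := fun n => Nat.rec H₀
    (fun n x => q * x - a * (μ.real (gapEvent b n) - q * x)) n
  have hsucc : ∀ n : ℕ, H (n + 1) = q * H n - a * (μ.real (gapEvent b n) - q * H n) :=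
    fun n => rfl
  -- The shape a (D - q^t H) in t survives the step in n because the conditional pair probability a
  -- (1 - q^t) has the same shape. Comparing the constant and the q^t terms gives the updates of D
  -- and H.
  have key : ∀ n t : ℕ, 1 ≤ t → μ.real (gapEvent b n ∩ {x | x ((n : ℤ) + t) = true}) =
      a * (μ.real (gapEvent b n) - q ^ t * H n) := by
    intro n
    induction n with
    | zero =>
      intro t ht
      rw [Nat.cast_zero, zero_add]
      exact h0 t ht
    | succ n ih =>
      intro t ht
      rw [h.measureReal_gapEvent_inter b n t hb ht (ha ▸ ha0), ih (t + 1) (by omega),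
        measureReal_gapEvent_succ b n hb, ih 1 le_rfl, hu t ht, ha, hsucc]
      field_simp
      ring
  have key1 : ∀ n : ℕ, μ.real (gapEvent b n ∩ {x | x ((n : ℤ) + (1 : ℕ)) = true}) =
      a * (μ.real (gapEvent b n) - q * H n) := fun n => by
    rw [key n 1 le_rfl, pow_one]
  exact ⟨H, rfl, key1, fun n => by rw [measureReal_gapEvent_succ b n hb, key1], hsucc⟩

end Renewal

lemma gapEvent_zero_zero : gapEvent 0 0 = {x : ℤ → Bool | x 0 = true} := by
  ext x; simp [gapEvent]

lemma gapEvent_one_zero : gapEvent 1 0 = Set.univ := by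
  ext x; simp [gapEvent]

lemma one_inter_firstOneAt (n : ℕ) :
    {x : ℤ → Bool | x 0 = true} ∩ firstOneAt (n + 1) =
      gapEvent 0 n ∩ {x | x ((n : ℤ) + (1 : ℕ)) = true} := by
  ext x
  constructor
  · rintro ⟨h0, ⟨-, h1⟩, h2⟩
    refine ⟨fun j hj => ?_, by simpa using h1⟩
    rw [Finset.mem_Icc] at hj
    by_cases hj0 : j = 0
    · rw [decide_eq_true hj0, hj0]; exact h0
    · rw [decide_eq_false hj0, Bool.eq_false_iff]
      intro hx
      have := h2 (show j.toNat ∈ _ from ⟨by omega, by rwa [Int.toNat_of_nonneg hj.1]⟩)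
      omega
  · rintro ⟨h1, h2⟩
    refine ⟨?_, ⟨by omega, by simpa using h2⟩, ?_⟩
    · simpa using h1 0 (Finset.mem_Icc.2 (by omega))
    · rintro k ⟨hk1, hk2⟩
      by_contra hlt
      have := h1 k (Finset.mem_Icc.2 (by omega))
      rw [hk2, decide_eq_false (by omega)] at this
      exact absurd this (by simp)

/-- The pair correlations of a process with geometric gaps. -/
lemma HasGaps.measureReal_pair {μ : Measure (ℤ → Bool)} {a : ℝ} {u : ℕ → ℝ}
    (h : HasGaps (fun S => μ.real (onesOn S)) a u) (t : ℕ) (ht : 1 ≤ t) :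
    μ.real ({x | x 0 = true} ∩ {x | x t = true}) = a * u t := by
  have h1 := h.insert_insert ∅ 0 t (by simp) (by exact_mod_cast ht)
  simp only [insert_empty_eq, sub_zero, Int.toNat_natCast] at h1
  rw [show μ.real (onesOn {0}) = a from h.singleton 0, onesOn_pair, Set.inter_comm] at h1
  exact h1

/-! ### The law of the rungs -/

/-- The transfer map of the site `m` on configurations with the rungs of `S` present. -/
def rungSite (α : ℝ) (S : Finset ℤ) (m : ℤ) (v : ℝ × ℝ) : ℝ × ℝ :=
  if m ∈ S then ((1 - α) ^ 2 * (v.1 + v.2), 0) else freeMap α v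

/-- Forcing the rung kills the second coordinate and makes the first depend on v.1 + v.2 alone. This
rank one map is the source of the renewal property. -/
lemma siteMap_rungs {α : ℝ} (h0 : 0 < α) (S : Finset ℤ) :
    siteMap α (constrainedWeight (rungWeight α) (S.image zEdge) fun _ => true) = rungSite α S := by
  funext m v
  have hh : ∀ m, hEdge 2 m ∉ S.image zEdge := by
    intro m hm
    obtain ⟨k, -, hk⟩ := Finset.mem_image.1 hm
    exact zEdge_ne_hEdge _ _ hk
  have hz : zEdge m ∈ S.image zEdge ↔ m ∈ S := by
    rw [Finset.mem_image]
    exact ⟨fun ⟨k, hk, e⟩ => zEdge_injective e ▸ hk, fun h => ⟨m, h, rfl⟩⟩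
  by_cases hm : m ∈ S
  · have hz' := hz.2 hm
    unfold rungSite
    rw [if_pos hm]
    simp only [siteMap, constrainedWeight, hz', hh, if_false, zWeight_zEdge,
      zWeight_hEdge, rungWeight, if_true, Bool.false_eq_true, ne_eq, not_true_eq_false, and_false,
      not_false_eq_true, and_true]
    ext
    · field_simp
      ring
    · ring
  · have hz' : zEdge m ∉ S.image zEdge := fun h => hm (hz.1 h)
    unfold rungSite
    rw [if_neg hm, siteMap_free h0 hz' (hh m)]

/-- Ensures that `ENNReal.ofReal` does not truncate the limiting cylinder probabilities. -/
lemma rungSite_nonneg {α : ℝ} (h0 : 0 < α) (h1 : α < 1) (S : Finset ℤ) (m : ℤ) {v : ℝ × ℝ}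
    (hv : 0 ≤ v) : 0 ≤ rungSite α S m v := by
  obtain ⟨h2, h3⟩ := hv
  simp only [Prod.fst_zero, Prod.snd_zero] at h2 h3
  have : 0 ≤ 1 - α := by linarith
  unfold rungSite freeMap
  split_ifs
  · exact ⟨by simp only [Prod.fst_zero]; positivity, le_rfl⟩
  · exact ⟨by simp only [Prod.fst_zero]; positivity, by simp only [Prod.snd_zero]; positivity⟩

lemma rungLaw_onesOn {α : ℝ} (h0 : 0 < α) (h1 : α < 1) (S : Finset ℤ) {K : ℕ}
    (hK : ∀ m ∈ S, -(K : ℤ) < m ∧ m ≤ K) :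
    (rungLaw α).real (onesOn S) =
      weightFun α (iterSites (rungSite α S) (-K) (2 * K) (statVec α)) / (1 - α) := by
  have hα : 0 ≤ 1 - α := by linarith
  have hm : Measurable (fun (ω : Sym2 ℤ → Bool) (m : ℤ) => ω (zEdge m)) :=
    measurable_pi_lambda _ fun m => measurable_pi_apply _
  have hK' : ∀ m : ℤ, (zEdge m ∈ S.image zEdge ∨ hEdge 2 m ∈ S.image zEdge) →
      -(K : ℤ) < m ∧ m ≤ K := by
    rintro m (h | h)
    · obtain ⟨k, hk, e⟩ := Finset.mem_image.1 h
      exact zEdge_injective e ▸ hK k hk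
    · obtain ⟨k, -, e⟩ := Finset.mem_image.1 h
      exact absurd e (zEdge_ne_hEdge _ _)
  have hlim := tendsto_nhds_unique
    ((isLimitMeasure_zigzagTree h0 h1).2 (S.image zEdge) fun _ => true)
    (tendsto_zigzagFinite h0 h1 (S.image zEdge) (fun _ => true) hK')
  have hnn : (0 : ℝ × ℝ) ≤ iterSites (rungSite α S) (-K) (2 * K) (statVec α) := by
    generalize 2 * K = j
    induction j with
    | zero =>
      refine ⟨?_, ?_⟩ <;> simp only [iterSites, statVec, Prod.fst_zero, Prod.snd_zero] <;> positivity
    | succ j ih => exact rungSite_nonneg h0 h1 S _ ih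
  have hκ : ∀ e ∈ S.image zEdge, (∀ n : ℕ, e ∉ ladderEdges (-(n : ℤ)) n) → true = false := by
    intro e he hn
    obtain ⟨k, hk, rfl⟩ := Finset.mem_image.1 he
    have := hK k hk
    exact absurd (zEdge_mem (by omega) (by omega)) (hn (k.natAbs + 1))
  rw [if_pos hκ, one_mul, siteMap_rungs h0] at hlim
  unfold rungLaw
  rw [if_neg h0.ne', Measure.real, Measure.map_apply hm (measurableSet_onesOn S)]
  have e : (fun (ω : Sym2 ℤ → Bool) (m : ℤ) => ω (zEdge m)) ⁻¹' onesOn S =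
      {ω | ∀ e ∈ S.image zEdge, ω e = true} := by
    ext ω; simp [onesOn]
  rw [e, hlim, ENNReal.toReal_ofReal]
  have h2 := hnn.1
  have h3 := hnn.2
  simp only [Prod.fst_zero, Prod.snd_zero] at h2 h3
  unfold weightFun
  positivity

lemma isProbabilityMeasure_rungLaw {α : ℝ} (h0 : 0 ≤ α) (h1 : α < 1) :
    IsProbabilityMeasure (rungLaw α) := by
  unfold rungLaw
  split_ifs with h
  · infer_instance
  · have h0' : 0 < α := lt_of_le_of_ne h0 (Ne.symm h)
    have := (isLimitMeasure_zigzagTree h0' h1).1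
    exact Measure.isProbabilityMeasure_map
      (measurable_pi_lambda _ fun m => measurable_pi_apply _).aemeasurable

lemma iterSites_rungSite_free {α : ℝ} {S : Finset ℤ} {a : ℤ} {j : ℕ}
    (h : ∀ m ∈ S, m ≤ a ∨ a + j < m) (v : ℝ × ℝ) :
    iterSites (rungSite α S) a j v = (freeMap α)^[j] v := by
  refine iterSites_eq_iterate (fun m h1 h2 => ?_) v
  funext w
  unfold rungSite
  rw [if_neg]
  intro hm
  have := h m hm
  omega

/-- Splitting the transfer at the largest rung `t`. -/
lemma iterSites_rungSite_insert {α : ℝ} {S : Finset ℤ} {t : ℤ} {K : ℕ} (hS : ∀ x ∈ S, x < t)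
    (hK : -(K : ℤ) < t ∧ t ≤ K) (v : ℝ × ℝ) :
    iterSites (rungSite α (insert t S)) (-K) (2 * K) v =
      (freeMap α)^[(K - t).toNat] ((1 - α) ^ 2 *
        ((iterSites (rungSite α S) (-K) (t - 1 + K).toNat v).1 +
          (iterSites (rungSite α S) (-K) (t - 1 + K).toNat v).2), 0) := by
  have e : 2 * K = (t - 1 + K).toNat + 1 + (K - t).toNat := by omega
  rw [e, iterSites_add, iterSites_rungSite_free, iterSites]
  · congr 1
    have e2 : -(K : ℤ) + ((t - 1 + K).toNat : ℕ) + 1 = t := by omega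
    rw [e2, iterSites_congr (τ := rungSite α S)]
    · unfold rungSite
      rw [if_pos (Finset.mem_insert_self _ _)]
    · intro m h1 h2
      funext w
      unfold rungSite
      have : m ≠ t := by omega
      simp [this]
  · intro m hm
    left
    rcases Finset.mem_insert.1 hm with rfl | h
    · push_cast; omega
    · have := hS m h
      push_cast; omega

/-- After the rung s the vector is a multiple of (1, 0), whatever the past. Applying d - 1 free
steps to (1, 0) gives coordinates with sum (1 - α^(2d)) / (1 - α²), where d = t - s, and the rung t
multiplies this by (1 - α)². -/
lemma hasGaps_rungLaw {α : ℝ} (h0 : 0 ≤ α) (h1 : α < 1) :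
    HasGaps (fun S => (rungLaw α).real (onesOn S)) ((1 - α) / (1 + α))
      (fun d => (1 - α) / (1 + α) * (1 - α ^ (2 * d))) := by
  have := isProbabilityMeasure_rungLaw h0 h1
  rcases h0.eq_or_lt with rfl | h0'
  · have h : ∀ S, (rungLaw 0).real (onesOn S) = 1 := by
      intro S
      unfold rungLaw
      rw [if_pos rfl, Measure.real, Measure.dirac_apply' _ (measurableSet_onesOn S)]
      simp [onesOn]
    refine ⟨h _, fun t => by simp [h], fun S s t _ hst => ?_⟩
    have : (t - s).toNat ≠ 0 := by omega
    simp [h, this]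
  · have hα : 1 - α ≠ 0 := by linarith
    refine ⟨by simp [onesOn_empty], fun t => ?_, fun S s t hS hst => ?_⟩
    · have hK : ∀ m ∈ insert t (∅ : Finset ℤ), -((t.natAbs + 1 : ℕ) : ℤ) < m ∧
          m ≤ (t.natAbs + 1 : ℕ) := by
        intro m hm
        simp only [insert_empty_eq, Finset.mem_singleton] at hm
        omega
      rw [← insert_empty_eq t, rungLaw_onesOn h0' h1 _ hK, iterSites_rungSite_insert (by simp)
        (hK t (by simp)), weightFun_iterate, iterSites_rungSite_free (by simp),
        iterate_freeMap_statVec α h0']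
      unfold weightFun statVec
      simp only
      field_simp
      ring
    · set K := s.natAbs + t.natAbs + (S.sup Int.natAbs) + 1 with hKdef
      have hK : ∀ m ∈ insert t (insert s S), -(K : ℤ) < m ∧ m ≤ K := by
        intro m hm
        rw [Finset.mem_insert, Finset.mem_insert] at hm
        rcases hm with rfl | rfl | hm
        · omega
        · omega
        · have : m.natAbs ≤ S.sup Int.natAbs := Finset.le_sup (f := Int.natAbs) hm
          omega
      have hs := hK s (by simp)
      have ht := hK t (by simp)
      have hT : ∀ x ∈ insert s S, x < t := by
        intro x hx
        rcases Finset.mem_insert.1 hx with rfl | hx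
        · exact hst
        · exact (hS x hx).trans hst
      rw [rungLaw_onesOn h0' h1 _ hK, rungLaw_onesOn h0' h1 (insert s S)
        (fun m hm => hK m (Finset.mem_insert_of_mem hm)), iterSites_rungSite_insert hT ht,
        weightFun_iterate, iterSites_rungSite_insert hS hs, weightFun_iterate]
      have e1 : (t - 1 + K).toNat = (s - 1 + K).toNat + 1 + (t - s - 1).toNat := by omega
      have e2 : -(K : ℤ) + ((s - 1 + K).toNat : ℕ) + 1 = s := by omega
      rw [e1, iterSites_add, iterSites_rungSite_free (a := -(K : ℤ) + _), iterSites, e2,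
        iterSites_congr (σ := rungSite α (insert s S)) (τ := rungSite α S)]
      · rw [show rungSite α (insert s S) s = fun v => ((1 - α) ^ 2 * (v.1 + v.2), 0) by
          funext v; unfold rungSite; rw [if_pos (Finset.mem_insert_self _ _)]]
        beta_reduce
        generalize (1 - α) ^ 2 * ((iterSites (rungSite α S) (-(K : ℤ)) (s - 1 + K).toNat
          (statVec α)).1 + (iterSites (rungSite α S) (-(K : ℤ)) (s - 1 + K).toNat
          (statVec α)).2) = ρ
        have e3 : (t - s).toNat = (t - s - 1).toNat + 1 := by omega
        rw [e3]
        generalize (t - s - 1).toNat = k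
        rw [fst_eq h0' ((freeMap α)^[k] _), snd_eq h0' h1 ((freeMap α)^[k] _), weightFun_iterate,
          decayFun_iterate]
        unfold weightFun decayFun
        simp only
        field_simp
        ring
      · intro m h1 h2
        funext w
        unfold rungSite
        have : m ≠ s := by omega
        simp [this]
      · intro m hm
        left
        rcases Finset.mem_insert.1 hm with rfl | h
        · push_cast; omega
        · have := hS m h
          push_cast; omega

/-- The distribution of the first return of the rung process. -/
lemma rungLaw_firstOneAt {α : ℝ} (h0 : 0 ≤ α) (h1 : α < 1) (m : ℕ) (hm : 1 ≤ m) :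
    cond (rungLaw α) {x | x 0 = true} (firstOneAt m) =
      ENNReal.ofReal ((1 - α) ^ 2 * m * α ^ (m - 1)) := by
  have := isProbabilityMeasure_rungLaw h0 h1
  have hg := hasGaps_rungLaw h0 h1
  set a := (1 - α) / (1 + α) with ha
  have hα : 0 < 1 - α := by linarith
  have ha0 : 0 < a := by rw [ha]; positivity
  have hone : (rungLaw α).real {x | x 0 = true} = a := by
    rw [← onesOn_singleton]; exact hg.singleton 0
  have hu : ∀ t : ℕ, 1 ≤ t → (rungLaw α).real ({x | x 0 = true} ∩ {x | x t = true}) =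
      a * (a * (1 - (α ^ 2) ^ t)) := by
    intro t ht
    rw [hg.measureReal_pair t ht, pow_mul]
  obtain ⟨H, hH0, hJ, hD, hH⟩ := (isRenewal_of_hasGaps hg).exists_gap_recursion (H₀ := a) 0
    zero_le_one hone ha0.ne' hu (fun t ht => by
      rw [gapEvent_zero_zero, hu t ht, hone]; ring)
  -- For a = (1-α)/(1+α) and q = α² the recursion has the double root α, whence a linear function of
  -- n times a power. Tracking α H instead of H avoids α^(n-1), so α = 0 needs no separate case.
  have key : ∀ n : ℕ, (rungLaw α).real (gapEvent 0 n) = a * (α ^ n * (1 + n * (1 - α))) ∧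
      α * H n = a * ((n + 1) * α ^ (n + 1) - n * α ^ n) := by
    intro n
    induction n with
    | zero => simp [gapEvent_zero_zero, hone, hH0]; ring
    | succ n ih =>
      obtain ⟨ih1, ih2⟩ := ih
      have e : α ^ 2 * H n = α * (α * H n) := by ring
      rw [hD, hH, e, ih2, ih1, ha]
      constructor <;> · push_cast; field_simp; ring
  obtain ⟨n, rfl⟩ : ∃ n, m = n + 1 := ⟨m - 1, by omega⟩
  have hr : (cond (rungLaw α) {x | x 0 = true}).real (firstOneAt (n + 1)) =
      (1 - α) ^ 2 * (n + 1 : ℕ) * α ^ n := by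
    rw [Measure.real, cond_apply (measurableSet_one 0), one_inter_firstOneAt, ENNReal.toReal_mul,
      ENNReal.toReal_inv]
    change ((rungLaw α).real _)⁻¹ * (rungLaw α).real _ = _
    rw [hJ n, hone, (key n).1,
      show α ^ 2 * H n = α * (α * H n) by ring, (key n).2, ha]
    push_cast
    field_simp
    ring
  rw [Nat.add_sub_cancel, ← hr, ofReal_measureReal]

/-! ### Fourier coefficients of the density -/

/-- The Poisson kernel, as the sum of the geometric series over j ≥ 0 and j < 0. On the unit circle
w⁻¹ is the conjugate of w, so the product of the denominators is real. -/
lemma hasSum_poisson {α : ℝ} (h0 : 0 ≤ α) (h1 : α < 1) {w : ℂ} (hw : ‖w‖ = 1) :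
    HasSum (fun j : ℤ => (α : ℂ) ^ j.natAbs * w ^ j)
      (((1 - α ^ 2) / (1 - 2 * α * w.re + α ^ 2) : ℝ) : ℂ) := by
  have hw0 : w ≠ 0 := by rintro rfl; simp at hw
  have hn : ∀ z : ℂ, ‖z‖ = 1 → ‖(α : ℂ) * z‖ < 1 := by
    intro z hz
    rw [norm_mul, hz, mul_one, Complex.norm_real, Real.norm_of_nonneg h0]
    exact h1
  have hne : ∀ z : ℂ, ‖z‖ = 1 → (1 - (α : ℂ) * z) ≠ 0 := by
    intro z hz h
    have := hn z hz
    rw [← sub_eq_zero.1 h] at this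
    simp at this
  have hinv : ‖w⁻¹‖ = 1 := by rw [norm_inv, hw, inv_one]
  have hp := hasSum_geometric_of_norm_lt_one (hn w hw)
  have hm := (hasSum_geometric_of_norm_lt_one (hn _ hinv)).mul_left ((α : ℂ) * w⁻¹)
  have hs := HasSum.of_nat_of_neg_add_one (f := fun j : ℤ => (α : ℂ) ^ j.natAbs * w ^ j)
    (hp.congr_fun fun n => ?_) (hm.congr_fun fun n => ?_)
  · convert hs using 1
    have hc : w + w⁻¹ = 2 * (w.re : ℂ) := by
      rw [Complex.inv_eq_conj hw, Complex.add_conj]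
      push_cast; ring
    have hden : (1 - (α : ℂ) * w) * (1 - (α : ℂ) * w⁻¹) =
        ((1 - 2 * α * w.re + α ^ 2 : ℝ) : ℂ) := by
      have : w * w⁻¹ = 1 := mul_inv_cancel₀ hw0
      push_cast
      linear_combination (α : ℂ) ^ 2 * this - (α : ℂ) * hc
    have e1 := hne w hw
    have e2 := hne _ hinv
    have hww : w * w⁻¹ = 1 := mul_inv_cancel₀ hw0
    rw [Complex.ofReal_div, ← hden, div_eq_iff (mul_ne_zero e1 e2)]
    have i1 := inv_mul_cancel₀ e1
    have i2 := inv_mul_cancel₀ e2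
    generalize w⁻¹ = v at *
    push_cast
    linear_combination (α : ℂ) ^ 2 * hww - (1 - (α : ℂ) * v) * i1 - α * v * (1 - α * w) * i2
  · simp [mul_pow]
  · have : (-((n : ℤ) + 1)).natAbs = n + 1 := by omega
    simp only [this, mul_pow, zpow_neg, ← inv_zpow]
    norm_cast
    rw [pow_succ, pow_succ, Complex.ofReal_mul]
    push_cast
    ring

lemma integral_exp_int (m : ℤ) :
    ∫ x in Set.Icc (0 : ℝ) 1, Complex.exp (2 * Real.pi * Complex.I * m * x) =
      if m = 0 then 1 else 0 := by
  rw [integral_Icc_eq_integral_Ioc, ← intervalIntegral.integral_of_le zero_le_one]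
  split_ifs with h
  · simp [h]
  · have hc : (2 * Real.pi * Complex.I * m : ℂ) ≠ 0 := by
      simp [Real.pi_ne_zero, h]
    rw [integral_exp_mul_complex hc]
    have : Complex.exp (2 * Real.pi * Complex.I * m * (1 : ℝ)) = 1 := by
      rw [Complex.exp_eq_one_iff]
      exact ⟨m, by push_cast; ring⟩
    rw [this]
    simp

lemma density_eq_poisson {α : ℝ} (h0 : 0 ≤ α) (p x : ℝ) :
    density α p x = p * ((1 - α) / (1 + α)) *
      ((1 - α ^ 2) / (1 - 2 * α * Real.cos (2 * Real.pi * x) + α ^ 2)) := by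
  unfold density rungWeight
  split_ifs with h
  · simp [h]
  · have h0' : 0 < α := lt_of_le_of_ne h0 (Ne.symm h)
    have e : (1 - α) ^ 2 / α + 2 - 2 * Real.cos (2 * Real.pi * x) =
        (1 - 2 * α * Real.cos (2 * Real.pi * x) + α ^ 2) / α := by
      field_simp; ring
    rw [e]
    have h1 : 1 + α ≠ 0 := by positivity
    rcases eq_or_ne (1 - 2 * α * Real.cos (2 * Real.pi * x) + α ^ 2) 0 with h2 | h2
    · simp [h2]
    · field_simp
      ring

/-- The density is a multiple of the Poisson kernel at exp(2πix). Summability of α^|j| permits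
termwise integration, and orthogonality leaves the term j = k. -/
lemma fourierInt_density {α : ℝ} (h0 : 0 ≤ α) (h1 : α < 1) (p : ℝ) (k : ℤ) :
    fourierInt (density α p) k = ((p * ((1 - α) / (1 + α)) * α ^ k.natAbs : ℝ) : ℂ) := by
  set a := p * ((1 - α) / (1 + α)) with ha
  let F : ℤ → ℝ → ℂ := fun j x =>
    (a * (α : ℂ) ^ j.natAbs) * Complex.exp (2 * Real.pi * Complex.I * (j - k : ℤ) * x)
  have hpt : ∀ x : ℝ, HasSum (fun j => F j x)
      ((density α p x : ℂ) * Complex.exp (-2 * Real.pi * Complex.I * k * x)) := by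
    intro x
    have hw : ‖Complex.exp (2 * Real.pi * Complex.I * x)‖ = 1 := by
      have : (2 * Real.pi * Complex.I * x : ℂ) = ((2 * Real.pi * x : ℝ) : ℂ) * Complex.I := by
        push_cast; ring
      rw [this, Complex.norm_exp_ofReal_mul_I]
    have hre : (Complex.exp (2 * Real.pi * Complex.I * x)).re = Real.cos (2 * Real.pi * x) := by
      have : (2 * Real.pi * Complex.I * x : ℂ) = ((2 * Real.pi * x : ℝ) : ℂ) * Complex.I := by
        push_cast; ring
      rw [this, Complex.exp_ofReal_mul_I_re]
    have h := ((hasSum_poisson h0 h1 hw).mul_left (a : ℂ)).mul_right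
      (Complex.exp (-2 * Real.pi * Complex.I * k * x))
    rw [hre, ← Complex.ofReal_mul, ← density_eq_poisson h0 p x] at h
    refine h.congr_fun fun j => ?_
    simp only [F]
    rw [← Complex.exp_int_mul, ← mul_assoc, mul_assoc _ (Complex.exp _) (Complex.exp _),
      ← Complex.exp_add]
    congr 2
    push_cast; ring
  have hnorm : ∀ j x, ‖F j x‖ = |a| * α ^ j.natAbs := by
    intro j x
    have : (2 * Real.pi * Complex.I * (j - k : ℤ) * x : ℂ) =
        ((2 * Real.pi * (j - k : ℤ) * x : ℝ) : ℂ) * Complex.I := by push_cast; ring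
    simp only [F]
    rw [this, norm_mul, Complex.norm_exp_ofReal_mul_I, norm_mul, norm_pow, Complex.norm_real,
      Complex.norm_real, Real.norm_of_nonneg h0, Real.norm_eq_abs, mul_one]
  have hsum : Summable fun j : ℤ => |a| * α ^ j.natAbs := by
    have hg := summable_geometric_of_lt_one h0 h1
    refine Summable.mul_left _ (Summable.of_nat_of_neg ?_ ?_)
    · simpa using hg
    · simpa using hg
  have hF : ∀ j, Integrable (F j) (volume.restrict (Set.Icc (0 : ℝ) 1)) := by
    intro j
    have : Continuous (F j) := by fun_prop
    exact this.integrableOn_Icc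
  have hI := hasSum_integral_of_summable_integral_norm hF (by
    simp only [hnorm]
    simpa using hsum)
  have hint : ∀ j, ∫ x in Set.Icc (0 : ℝ) 1, F j x =
      if j = k then (a * (α : ℂ) ^ k.natAbs) else 0 := by
    intro j
    simp only [F]
    rw [integral_const_mul, integral_exp_int]
    by_cases h : j = k
    · rw [if_pos (sub_eq_zero.2 h), if_pos h, h, mul_one]
    · rw [if_neg (mt sub_eq_zero.1 h), if_neg h, mul_zero]
  simp only [hint, (hpt _).tsum_eq] at hI
  have := hI.unique (hasSum_ite_eq k _)
  unfold fourierInt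
  rw [this]
  push_cast
  ring

lemma toeplitz_density {α : ℝ} (h0 : 0 ≤ α) (h1 : α < 1) (p : ℝ) :
    toeplitz (density α p) = geomToeplitz ((p * ((1 - α) / (1 + α)) : ℝ) : ℂ) α := by
  ext k l
  simp only [toeplitz, geomToeplitz, Matrix.of_apply, fourierInt_density h0 h1]
  push_cast
  ring

/-! ### Determinantal processes with geometric Toeplitz matrices -/

lemma isHermitian_geomToeplitz (a b : ℝ) : (geomToeplitz (a : ℂ) (b : ℂ)).IsHermitian := by
  ext k l
  have : (k - l).natAbs = (l - k).natAbs := by omega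
  simp [geomToeplitz, this]

/-- Inclusion probabilities and principal minors have the same gaps. The exponent is even, so b and
-b serve the same process. -/
lemma isDeterminantal_of_hasGaps {μ : Measure (ℤ → Bool)} {a b : ℝ}
    (h : HasGaps (fun S => μ.real (onesOn S)) a (fun d => a * (1 - b ^ (2 * d)))) :
    IsDeterminantal μ (geomToeplitz (a : ℂ) (b : ℂ)) := by
  refine ⟨isHermitian_geomToeplitz a b, fun S => ?_⟩
  have h1 := h.map Complex.ofRealHom
  have h2 := hasGaps_minor_geomToeplitz (a : ℂ) (b : ℂ)
  have e : (fun d : ℕ => Complex.ofRealHom (a * (1 - b ^ (2 * d)))) =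
      fun d : ℕ => (a : ℂ) * (1 - (b : ℂ) ^ (2 * d)) := by
    ext d; simp
  rw [e] at h1
  exact h1.unique h2 S

/-! ### Thinning -/

lemma measurable_and : Measurable (fun (q : (ℤ → Bool) × (ℤ → Bool)) m => q.1 m && q.2 m) := by
  refine measurable_pi_lambda _ fun m => ?_
  have : Measurable fun b : Bool × Bool => b.1 && b.2 := measurable_of_countable _
  have h : Measurable fun q : (ℤ → Bool) × (ℤ → Bool) => (q.1 m, q.2 m) := by fun_prop
  exact this.comp h

lemma isProbabilityMeasure_thinning (p : unitInterval) (μ : Measure (ℤ → Bool))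
    [IsProbabilityMeasure μ] : IsProbabilityMeasure (thinning p μ) :=
  Measure.isProbabilityMeasure_map measurable_and.aemeasurable

lemma thinning_onesOn (p : unitInterval) (μ : Measure (ℤ → Bool)) [IsProbabilityMeasure μ]
    (S : Finset ℤ) : (thinning p μ).real (onesOn S) = (p : ℝ) ^ S.card * μ.real (onesOn S) := by
  have e : (fun (q : (ℤ → Bool) × (ℤ → Bool)) m => q.1 m && q.2 m) ⁻¹' onesOn S =
      onesOn S ×ˢ onesOn S := by
    ext q
    simp only [onesOn, Set.mem_preimage, Set.mem_ofPred_eq, Bool.and_eq_true, Set.mem_prod]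
    exact ⟨fun h => ⟨fun s hs => (h s hs).1, fun s hs => (h s hs).2⟩,
      fun h s hs => ⟨h.1 s hs, h.2 s hs⟩⟩
  have e2 : (onesOn S : Set (ℤ → Bool)) = Set.pi S fun _ => {true} := by
    ext x; simp [onesOn, Set.pi]
  have h2 : (Measure.infinitePi (fun _ : ℤ => bernoulliMeasure true false p)).real (onesOn S) =
      (p : ℝ) ^ S.card := by
    rw [e2, Measure.real, Measure.infinitePi_pi _ fun _ _ => measurableSet_singleton _,
      ENNReal.toReal_prod]
    simp
  unfold thinning
  rw [Measure.real, Measure.map_apply measurable_and (measurableSet_onesOn S), e, Measure.prod_prod,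
    ENNReal.toReal_mul, mul_comm]
  congr 1

lemma hasGaps_thinning (p : unitInterval) {α : ℝ} (h0 : 0 ≤ α) (h1 : α < 1) :
    HasGaps (fun S => (thinning p (rungLaw α)).real (onesOn S)) (p * ((1 - α) / (1 + α)))
      (fun d => p * ((1 - α) / (1 + α)) * (1 - α ^ (2 * d))) := by
  have := isProbabilityMeasure_rungLaw h0 h1
  have h := (hasGaps_rungLaw h0 h1).thin (p : ℝ)
  simp only [← mul_assoc, ← thinning_onesOn] at h
  exact h

/-! ### Small minors of Hermitian matrices -/

lemma minor_image_univ {R : Type*} [DecidableEq R] (A : Matrix R R ℂ) {n : ℕ} (e : Fin n → R)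
    (he : Function.Injective e) : minor A (Finset.univ.image e) = (A.submatrix e e).det := by
  classical
  let φ : Fin n ≃ {x // x ∈ Finset.univ.image e} :=
    Equiv.ofBijective (fun i => ⟨e i, Finset.mem_image_of_mem e (Finset.mem_univ i)⟩)
      ⟨fun i j h => he (congrArg Subtype.val h), fun x => by
        obtain ⟨i, -, hi⟩ := Finset.mem_image.1 x.2
        exact ⟨i, Subtype.ext hi⟩⟩
  have h : (A.submatrix (Subtype.val : {x // x ∈ Finset.univ.image e} → R) Subtype.val).det =
      (A.submatrix e e).det := by
    rw [← Matrix.det_submatrix_equiv_self φ]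
    rfl
  unfold minor
  convert h

lemma minor_pair {R : Type*} [DecidableEq R] {A : Matrix R R ℂ} (hA : A.IsHermitian) {i j : R}
    (hij : i ≠ j) : minor A {i, j} = A i i * A j j - (Complex.normSq (A i j) : ℂ) := by
  have h : ({i, j} : Finset R) = Finset.univ.image ![i, j] := by
    ext x; simp [Fin.exists_fin_two, eq_comm]
  rw [h, minor_image_univ, Matrix.det_fin_two, ← Complex.mul_conj]
  · have := hA.apply j i
    simp [← this]
  · intro a b hab
    fin_cases a <;> fin_cases b <;> simp_all [eq_comm]

/-- The two 3-cycles contribute complex conjugate terms; their sum is the only part that depends on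
the phases of `A`. -/
lemma minor_triple {R : Type*} [DecidableEq R] {A : Matrix R R ℂ} (hA : A.IsHermitian)
    {i j k : R} (hij : i ≠ j) (hik : i ≠ k) (hjk : j ≠ k) :
    minor A {i, j, k} = A i i * A j j * A k k - A i i * (Complex.normSq (A j k) : ℂ) -
      A j j * (Complex.normSq (A i k) : ℂ) - A k k * (Complex.normSq (A i j) : ℂ) +
      ((2 * (A i j * A j k * (starRingEnd ℂ) (A i k)).re : ℝ) : ℂ) := by
  have h : ({i, j, k} : Finset R) = Finset.univ.image ![i, j, k] := by
    ext x
    simp [Fin.exists_fin_succ, eq_comm]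
  have hre : ((2 * (A i j * A j k * (starRingEnd ℂ) (A i k)).re : ℝ) : ℂ) =
      A i j * A j k * (starRingEnd ℂ) (A i k) +
        (starRingEnd ℂ) (A i j * A j k * (starRingEnd ℂ) (A i k)) := (Complex.add_conj _).symm
  rw [h, minor_image_univ, Matrix.det_fin_three, hre, ← Complex.mul_conj, ← Complex.mul_conj,
    ← Complex.mul_conj]
  · have h1 : A j i = (starRingEnd ℂ) (A i j) := (hA.apply j i).symm
    have h2 : A k i = (starRingEnd ℂ) (A i k) := (hA.apply k i).symm
    have h3 : A k j = (starRingEnd ℂ) (A j k) := (hA.apply k j).symm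
    simp [h1, h2, h3]
    ring
  · intro a b hab
    fin_cases a <;> fin_cases b <;> simp_all [eq_comm]

/-! ### Nonnegative solutions of linear recursions -/

/-- A linear recursion of order two with complex characteristic roots has no nonnegative
solution which starts with a positive value. -/
lemma not_nonneg_of_complex_roots {τ q : ℝ} (hτ : τ ^ 2 < 4 * q) {D : ℕ → ℝ} (h0 : 0 < D 0)
    (hD : ∀ n, 0 ≤ D n) (hrec : ∀ n, D (n + 2) = τ * D (n + 1) - q * D n) : False := by
  have hq : 0 < q := by nlinarith [sq_nonneg τ]
  -- A zero after a positive value D n would be followed by -q D n < 0.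
  have hpos : ∀ n, 0 < D n := by
    intro n
    induction n with
    | zero => exact h0
    | succ n ih =>
      refine lt_of_le_of_ne (hD _) fun h => ?_
      have h1 := hrec n
      rw [← h] at h1
      have := hD (n + 2)
      nlinarith [mul_pos hq ih]
  -- The ratios satisfy r' = τ - q / r, and r² - τ r + q ≥ δ > 0. So they decrease by at least δ / r
  -- 0 at each step and finally become negative.
  set r : ℕ → ℝ := fun n => D (n + 1) / D n with hr
  have hrpos : ∀ n, 0 < r n := fun n => div_pos (hpos _) (hpos _)
  have hrrec : ∀ n, r (n + 1) * r n = τ * r n - q := by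
    intro n
    have h1 := (hpos n).ne'
    have h2 := (hpos (n + 1)).ne'
    simp only [hr]
    rw [show n + 1 + 1 = n + 2 from rfl, hrec n]
    field_simp
  set δ := q - τ ^ 2 / 4 with hδ
  have hδpos : 0 < δ := by rw [hδ]; linarith
  have hdec : ∀ n, r (n + 1) * r n ≤ r n * r n - δ := by
    intro n
    rw [hrrec]
    nlinarith [sq_nonneg (r n - τ / 2)]
  have hle : ∀ n, r n ≤ r 0 := by
    intro n
    induction n with
    | zero => exact le_rfl
    | succ n ih =>
      have : r (n + 1) * r n ≤ r n * r n := by linarith [hdec n]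
      exact (le_of_mul_le_mul_right this (hrpos n)).trans ih
  have hlin : ∀ n : ℕ, r n ≤ r 0 - n * (δ / r 0) := by
    intro n
    induction n with
    | zero => simp
    | succ n ih =>
      have h1 : r (n + 1) ≤ r n - δ / r n := by
        have h2 : (r n - δ / r n) * r n = r n * r n - δ := by
          have := (hrpos n).ne'
          field_simp
        exact le_of_mul_le_mul_right ((hdec n).trans h2.ge) (hrpos n)
      have h3 : δ / r 0 ≤ δ / r n := div_le_div_of_nonneg_left hδpos.le (hrpos n) (hle n)
      push_cast
      linarith
  obtain ⟨n, hn⟩ := exists_nat_gt (r 0 / (δ / r 0))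
  have h4 : 0 < δ / r 0 := div_pos hδpos (hrpos 0)
  rw [div_lt_iff₀ h4] at hn
  linarith [hlin n, hrpos n]

/-- The bound on the intensity of a renewal process with geometric pair probabilities. -/
lemma intensity_le_of_recursion {a b : ℝ} (ha : 0 < a) (ha1 : a ≤ 1) (hb : 0 ≤ b) (hb1 : b ≤ 1)
    {D H : ℕ → ℝ} (hD : ∀ n, 0 ≤ D n) (hD0 : D 0 = 1) (hH0 : H 0 = 0)
    (hDs : ∀ n, D (n + 1) = D n - a * (D n - b ^ 2 * H n))
    (hHs : ∀ n, H (n + 1) = b ^ 2 * H n - a * (D n - b ^ 2 * H n)) :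
    b < 1 ∧ a * (1 + b) ≤ 1 - b := by
  have hlt : b < 1 := by
    refine lt_of_le_of_ne hb1 fun h => ?_
    subst h
    -- For b = 1 the difference D - H is conserved, so D drops by a at every step and turns
    -- negative.
    have h1 : ∀ n, D n - H n = 1 := by
      intro n
      induction n with
      | zero => rw [hD0, hH0, sub_zero]
      | succ n ih => rw [hDs, hHs]; linear_combination ih
    have h2 : ∀ n : ℕ, D n = 1 - n * a := by
      intro n
      induction n with
      | zero => simp [hD0]
      | succ n ih =>
        rw [hDs]
        push_cast
        linear_combination ih - a * h1 n
    obtain ⟨n, hn⟩ := exists_nat_gt (1 / a)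
    rw [div_lt_iff₀ ha] at hn
    linarith [hD n, h2 n]
  refine ⟨hlt, ?_⟩
  by_contra! hlt'
  -- Eliminating H gives roots with product b² and sum τ, where τ - 2b = (1-b)² - a(1-b²). If the
  -- bound fails then 0 ≤ τ < 2b, and the roots are complex.
  have hrec : ∀ n, D (n + 2) = (1 - a + b ^ 2 * (1 + a)) * D (n + 1) - b ^ 2 * D n := by
    intro n
    rw [show n + 2 = n + 1 + 1 from rfl, hDs (n + 1), hHs n, hDs n]
    ring
  refine not_nonneg_of_complex_roots ?_ (by rw [hD0]; exact one_pos) hD hrec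
  have h1 : 1 - a + b ^ 2 * (1 + a) < 2 * b := by nlinarith
  have h2 : 0 ≤ 1 - a + b ^ 2 * (1 + a) := by nlinarith [sq_nonneg b]
  nlinarith

/-! ### Determinantal renewal processes -/

lemma IsStationary.onesOn_image {μ : Measure (ℤ → Bool)} (h : IsStationary μ) (k : ℤ) (S : Finset ℤ) :
    μ.real (onesOn (S.image (· + k))) = μ.real (onesOn S) := by
  have key : ∀ (k : ℕ) (S : Finset ℤ),
      μ.real (onesOn (S.image (· + (k : ℤ)))) = μ.real (onesOn S) := by
    intro k S
    rw [← h.measure_shift k (measurableSet_onesOn S)]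
    congr 1
    ext x
    change (∀ s ∈ S.image (· + (k : ℤ)), x s = true) ↔ ∀ s ∈ S, x (s + k) = true
    rw [Finset.forall_mem_image]
  obtain ⟨n, rfl | rfl⟩ := k.eq_nat_or_neg
  · exact key n S
  · rw [← key n (S.image (· + -(n : ℤ))), Finset.image_image]
    have e : (fun x : ℤ => x + n) ∘ (fun x => x + -(n : ℤ)) = id := by
      ext x; simp
    rw [e, Finset.image_id]

section Classification

variable {μ : Measure (ℤ → Bool)} [IsProbabilityMeasure μ]

lemma IsRenewal.onesOn_insert_insert (h : IsRenewal μ) (S : Finset ℤ) (s t : ℤ)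
    (hS : ∀ x ∈ S, x < s) (hst : s < t) :
    μ.real (onesOn (insert t (insert s S))) * μ.real (onesOn {0}) =
      μ.real (onesOn (insert s S)) * μ.real (onesOn {0, ((t - s).toNat : ℤ)}) := by
  have h1 := h.cylinder_mul (S.image (· + -s)) (fun _ => true) 0 (t - s).toNat (by
    intro j hj
    obtain ⟨x, hx, rfl⟩ := Finset.mem_image.1 hj
    have := hS x hx
    push_cast; omega) (by omega)
  have e1 : {x : ℤ → Bool | ∀ j ∈ S.image (· + -s), x j = true} ∩ {x | x ((0 : ℕ) : ℤ) = true} =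
      onesOn ((insert s S).image (· + -s)) := by
    rw [Finset.image_insert, Finset.insert_eq, Finset.union_comm, onesOn_union, onesOn_singleton]
    simp [onesOn]
  have e2 : onesOn ((insert s S).image (· + -s)) ∩
      {x : ℤ → Bool | x (((0 : ℕ) : ℤ) + (t - s).toNat) = true} =
      onesOn ((insert t (insert s S)).image (· + -s)) := by
    rw [Finset.image_insert _ t, Finset.insert_eq (t + -s), Finset.union_comm, onesOn_union,
      onesOn_singleton]
    have : ((0 : ℕ) : ℤ) + (t - s).toNat = t + -s := by omega
    rw [this]
  rw [e1, e2, h.1.onesOn_image, h.1.onesOn_image, ← onesOn_pair, ← onesOn_singleton] at h1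
  exact h1

/-- The pair probabilities of a determinantal renewal process are geometric. -/
lemma IsRenewal.exists_pair_eq (h : IsRenewal μ) {A : Matrix ℤ ℤ ℂ} (hA : IsDeterminantal μ A)
    {a : ℝ} (ha : μ.real (onesOn {0}) = a) (ha0 : 0 < a) :
    ∃ b : ℝ, 0 ≤ b ∧ b ≤ 1 ∧
      ∀ d : ℕ, 1 ≤ d → μ.real (onesOn {0, (d : ℤ)}) = a * (a * (1 - b ^ (2 * d))) := by
  have hm : ∀ S, ((μ.real (onesOn S) : ℝ) : ℂ) = minor A S := hA.2
  have hdiag : ∀ k, A k k = (a : ℂ) := by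
    intro k
    have e := h.1.onesOn_image k {0}
    rw [Finset.image_singleton, zero_add, ha] at e
    rw [← minor_singleton A k, ← hm, e]
  have hpair : ∀ (k : ℤ) (d : ℕ), 1 ≤ d →
      Complex.normSq (A k (k + d)) = a ^ 2 - μ.real (onesOn {0, (d : ℤ)}) := by
    intro k d hd
    have e := h.1.onesOn_image k {0, (d : ℤ)}
    rw [Finset.image_insert, Finset.image_singleton, zero_add, add_comm (d : ℤ) k] at e
    have e2 := hm {k, k + (d : ℤ)}
    rw [minor_pair hA.1 (by omega), hdiag, hdiag, e] at e2
    have e3 : μ.real (onesOn {0, (d : ℤ)}) = a * a - Complex.normSq (A k (k + d)) := by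
      exact_mod_cast e2
    linarith
  set q : ℕ → ℝ := fun d => a ^ 2 - μ.real (onesOn {0, (d : ℤ)}) with hq
  have hqnn : ∀ d : ℕ, 1 ≤ d → 0 ≤ q d := fun d hd => by
    have := Complex.normSq_nonneg (A 0 (0 + d))
    rwa [hpair 0 d hd] at this
  -- Renewal at d for {0, d, d + 1} fixes the cyclic term of the 3×3 minor: 2aρ = a²|w|² + |x|²|y|².
  -- Since ρ² ≤ |x|²|y|²|w|², equality must hold in the arithmetic-geometric mean inequality for the
  -- two summands, which are therefore equal.
  have hmul : ∀ d : ℕ, 1 ≤ d → a ^ 2 * q (d + 1) = q d * q 1 := by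
    intro d hd
    have e := h.onesOn_insert_insert {0} d (d + 1 : ℕ) (by simp; omega) (by push_cast; omega)
    have e0 : (((d + 1 : ℕ) : ℤ) - d).toNat = 1 := by push_cast; omega
    have e1 : (insert ((d + 1 : ℕ) : ℤ) (insert (d : ℤ) {0}) : Finset ℤ) =
        {0, (d : ℤ), ((d + 1 : ℕ) : ℤ)} := by
      ext x; simp only [Finset.mem_insert, Finset.mem_singleton]; tauto
    rw [e0, e1, Finset.pair_comm (d : ℤ) 0, ha] at e
    have e2 := hm {0, (d : ℤ), ((d + 1 : ℕ) : ℤ)}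
    have n1 := hpair 0 d hd
    have n2 := hpair d 1 le_rfl
    have n3 := hpair 0 (d + 1) (by omega)
    rw [zero_add] at n1 n3
    have e3 : (d : ℤ) + (1 : ℕ) = ((d + 1 : ℕ) : ℤ) := by push_cast; ring
    rw [e3] at n2
    rw [minor_triple hA.1 (by omega) (by omega) (by omega), hdiag, hdiag, hdiag] at e2
    set x := A 0 d
    set y := A d ((d + 1 : ℕ) : ℤ)
    set w := A 0 ((d + 1 : ℕ) : ℤ)
    set ρ := (x * y * (starRingEnd ℂ) w).re with hρ
    have e4 : μ.real (onesOn {0, (d : ℤ), ((d + 1 : ℕ) : ℤ)}) =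
        a * a * a - a * Complex.normSq y - a * Complex.normSq w - a * Complex.normSq x + 2 * ρ := by
      exact_mod_cast e2
    have hρ2 : ρ ^ 2 ≤ Complex.normSq x * Complex.normSq y * Complex.normSq w := by
      have h1 := Complex.re_sq_le_normSq (x * y * (starRingEnd ℂ) w)
      rw [Complex.normSq_mul, Complex.normSq_mul, Complex.normSq_conj] at h1
      nlinarith
    have m1 : q d = Complex.normSq x := n1.symm
    have m2 : q 1 = Complex.normSq y := n2.symm
    have m3 : q (d + 1) = Complex.normSq w := n3.symm
    have r1 : μ.real (onesOn {0, (d : ℤ)}) = a ^ 2 - Complex.normSq x := by rw [n1]; ring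
    have r2 : μ.real (onesOn {0, ((1 : ℕ) : ℤ)}) = a ^ 2 - Complex.normSq y := by rw [n2]; ring
    rw [r1, r2, e4] at e
    rw [m1, m2, m3]
    have key : 2 * a * ρ = a ^ 2 * Complex.normSq w + Complex.normSq x * Complex.normSq y := by
      linear_combination e
    have : (a ^ 2 * Complex.normSq w - Complex.normSq x * Complex.normSq y) ^ 2 ≤ 0 := by
      have h3 : (2 * a * ρ) ^ 2 = 4 * a ^ 2 * ρ ^ 2 := by ring
      rw [key] at h3
      nlinarith [mul_le_mul_of_nonneg_left hρ2 (by positivity : 0 ≤ 4 * a ^ 2)]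
    nlinarith [sq_nonneg (a ^ 2 * Complex.normSq w - Complex.normSq x * Complex.normSq y)]
  have ha2 : 0 < a ^ 2 := by positivity
  have hb2 : (Real.sqrt (q 1 / a ^ 2)) ^ 2 = q 1 / a ^ 2 :=
    Real.sq_sqrt (div_nonneg (hqnn 1 le_rfl) ha2.le)
  have hqd : ∀ d : ℕ, 1 ≤ d → q d = a ^ 2 * (q 1 / a ^ 2) ^ d := by
    intro d hd
    induction d, hd using Nat.le_induction with
    | base => field_simp
    | succ d hd ih =>
      have := hmul d hd
      rw [ih] at this
      have h5 : q (d + 1) = (q 1 / a ^ 2) ^ d * q 1 := by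
        have h6 : a ^ 2 * q (d + 1) = a ^ 2 * ((q 1 / a ^ 2) ^ d * q 1) := by rw [this]; ring
        exact mul_left_cancel₀ ha2.ne' h6
      rw [h5, pow_succ _ d]
      generalize (q 1 / a ^ 2) ^ d = z
      field_simp
  refine ⟨Real.sqrt (q 1 / a ^ 2), Real.sqrt_nonneg _, ?_, fun d hd => ?_⟩
  · refine Real.sqrt_le_iff.2 ⟨zero_le_one, ?_⟩
    rw [one_pow, div_le_one ha2]
    simp only [hq]
    linarith [measureReal_nonneg (μ := μ) (s := onesOn {0, ((1 : ℕ) : ℤ)})]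
  · have h7 := hqd d hd
    rw [← hb2, ← pow_mul] at h7
    simp only [hq] at h7
    linear_combination -h7

/-- A determinantal renewal process is a thinning of the process of rungs. -/
lemma IsRenewal.eq_thinning (h : IsRenewal μ) {A : Matrix ℤ ℤ ℂ} (hA : IsDeterminantal μ A) :
    ∃ (α : ℝ) (p : unitInterval), 0 ≤ α ∧ α < 1 ∧ μ = thinning p (rungLaw α) := by
  set a := μ.real (onesOn ({0} : Finset ℤ)) with ha
  have hsing : ∀ t, μ.real (onesOn ({t} : Finset ℤ)) = a := by
    intro t
    have := h.1.onesOn_image t {0}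
    rwa [Finset.image_singleton, zero_add] at this
  rcases (measureReal_nonneg : 0 ≤ a).eq_or_lt with ha0 | ha0
  -- Intensity zero is the empty process, obtained with p = 0; α = 0 is an arbitrary choice.
  · refine ⟨0, 0, le_rfl, one_pos, ?_⟩
    have := isProbabilityMeasure_rungLaw le_rfl one_pos
    have := isProbabilityMeasure_thinning 0 (rungLaw 0)
    have h1 := hasGaps_thinning 0 le_rfl one_pos
    have hg : HasGaps (fun S => μ.real (onesOn S)) 0 (fun _ => 0) := by
      refine ⟨by simp [onesOn_empty], fun t => (hsing t).trans ha0.symm, fun S s t _ _ => ?_⟩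
      rw [mul_zero]
      refine le_antisymm ?_ measureReal_nonneg
      refine le_trans ?_ ((hsing t).trans ha0.symm).le
      refine measureReal_mono (fun x hx => ?_) (measure_ne_top _ _)
      rw [onesOn_singleton]
      exact hx t (Finset.mem_insert_self _ _)
    refine eq_of_hasGaps hg ?_
    simpa using h1
  · obtain ⟨b, hb0, hb1, hpair⟩ := h.exists_pair_eq hA rfl ha0
    rw [← ha] at hpair
    have hone : μ.real {x : ℤ → Bool | x 0 = true} = a := by rw [ha, onesOn_singleton]
    have hu : ∀ t : ℕ, 1 ≤ t → μ.real ({x : ℤ → Bool | x 0 = true} ∩ {x | x t = true}) =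
        a * (a * (1 - (b ^ 2) ^ t)) := by
      intro t ht
      rw [← onesOn_pair, hpair t ht, pow_mul]
    obtain ⟨H, hH0, -, hD, hH⟩ := h.exists_gap_recursion (H₀ := 0) 1 le_rfl hone ha0.ne' hu
      (fun t ht => by
        rw [gapEvent_one_zero, Set.univ_inter, ← onesOn_singleton, hsing]; simp)
    obtain ⟨hblt, hab⟩ := intensity_le_of_recursion (D := fun n : ℕ => μ.real (gapEvent 1 n)) ha0
      measureReal_le_one hb0 hb1 (fun n => measureReal_nonneg) (by simp [gapEvent_one_zero]) hH0 hD hH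
    have hb' : 0 < 1 - b := by linarith
    -- The parameter p solves p (1 - b) / (1 + b) = a; the intensity bound says precisely that p ≤
    -- 1.
    refine ⟨b, ⟨a * (1 + b) / (1 - b), by positivity, (div_le_one hb').2 hab⟩, hb0, hblt, ?_⟩
    have := isProbabilityMeasure_rungLaw hb0 hblt
    have := isProbabilityMeasure_thinning ⟨a * (1 + b) / (1 - b), by positivity, (div_le_one hb').2 hab⟩
      (rungLaw b)
    have h1 := hasGaps_thinning ⟨a * (1 + b) / (1 - b), by positivity, (div_le_one hb').2 hab⟩
      hb0 hblt
    have e : a * (1 + b) / (1 - b) * ((1 - b) / (1 + b)) = a := by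
      have : 1 + b ≠ 0 := by positivity
      field_simp
    simp only [e] at h1
    refine eq_of_hasGaps ⟨by simp [onesOn_empty], hsing, fun S s t hS hst => ?_⟩ h1
    have h2 := h.onesOn_insert_insert S s t hS hst
    rw [hpair _ (by omega), ← ha] at h2
    have h3 : μ.real (onesOn (insert t (insert s S))) * a =
        μ.real (onesOn (insert s S)) * (a * (1 - b ^ (2 * (t - s).toNat))) * a := by
      rw [h2]; ring
    exact mul_right_cancel₀ ha0.ne' h3

end Classification

end SpanningLadder

end

/-! ### Assembly of the theorem. -/

open SpanningLadder in
theorem theorem2 :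
    -- the two descriptions of the relation between `c` and `α` are equivalent
    (∀ c α : ℝ, 0 < c →
      (α = 1 + c / 2 - Real.sqrt (4 * c + c ^ 2) / 2 ↔
        0 < α ∧ α < 1 ∧ c = (1 - α) ^ 2 / α)) ∧
    -- the weighted spanning tree measure exists
    (∀ c : ℝ, 0 < c → IsLimitMeasure (zigzagFinite c) (zigzagTree c)) ∧
    -- (i)
    (∀ α : ℝ, 0 ≤ α → α < 1 →
      IsDeterminantal (rungLaw α) (toeplitz (density α 1)) ∧
      (∀ k : ℤ, fourierInt (density α 1) k =
        (((1 - α) / (1 + α) * α ^ k.natAbs : ℝ) : ℂ)) ∧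
      IsDeterminantal (rungLaw α)
        (Matrix.of fun k l : ℤ =>
          (((1 - α) / (1 + α) * (-α) ^ (l - k).natAbs : ℝ) : ℂ)) ∧
      IsRenewal (rungLaw α) ∧
      (∀ m : ℕ, 1 ≤ m →
        cond (rungLaw α) {x | x 0 = true} (firstOneAt m) =
          ENNReal.ofReal ((1 - α) ^ 2 * m * α ^ (m - 1)))) ∧
    -- (ii)
    (∀ (α : ℝ) (p : unitInterval), 0 ≤ α → α < 1 →
      IsDeterminantal (thinning p (rungLaw α)) (((p : ℝ) : ℂ) • toeplitz (density α 1)) ∧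
      ((p : ℝ) : ℂ) • toeplitz (density α 1) = toeplitz (density α p)) ∧
    -- (iii)
    (∀ μ : MeasureTheory.Measure (ℤ → Bool), MeasureTheory.IsProbabilityMeasure μ →
      (∃ A : Matrix ℤ ℤ ℂ, IsDeterminantal μ A) → IsRenewal μ →
      ∃ (α : ℝ) (p : unitInterval), 0 ≤ α ∧ α < 1 ∧ μ = thinning p (rungLaw α)) := by
  refine ⟨fun c α hc => decayRate_iff hc, fun c hc => ?_, fun α h0 h1 => ?_, fun α p h0 h1 => ?_,
    fun μ hμ ⟨A, hA⟩ h => h.eq_thinning hA⟩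
  -- Here `rfl` lets α be the square root expression in c, so every c > 0 is a rung weight.
  · obtain ⟨h0, h1, h2⟩ := (decayRate_iff hc).1 rfl
    rw [h2]
    exact isLimitMeasure_zigzagTree h0 h1
  · have := isProbabilityMeasure_rungLaw h0 h1
    have hg := hasGaps_rungLaw h0 h1
    refine ⟨?_, fun k => ?_, ?_, isRenewal_of_hasGaps hg, rungLaw_firstOneAt h0 h1⟩
    · rw [toeplitz_density h0 h1, one_mul]
      exact isDeterminantal_of_hasGaps hg
    · rw [fourierInt_density h0 h1, one_mul]
    · have e : (Matrix.of fun k l : ℤ => (((1 - α) / (1 + α) * (-α) ^ (l - k).natAbs : ℝ) : ℂ)) =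
          geomToeplitz (((1 - α) / (1 + α) : ℝ) : ℂ) ((-α : ℝ) : ℂ) := by
        ext k l
        simp [geomToeplitz]
      rw [e]
      refine isDeterminantal_of_hasGaps ?_
      have e2 : (fun d : ℕ => (1 - α) / (1 + α) * (1 - (-α) ^ (2 * d))) =
          fun d : ℕ => (1 - α) / (1 + α) * (1 - α ^ (2 * d)) := by
        ext d
        rw [(even_two_mul d).neg_pow]
      rw [e2]
      exact hg
  · have e : ((p : ℝ) : ℂ) • toeplitz (density α 1) = toeplitz (density α p) := by
      rw [toeplitz_density h0 h1, toeplitz_density h0 h1]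
      ext k l
      simp [geomToeplitz, mul_assoc]
    refine ⟨?_, e⟩
    rw [e, toeplitz_density h0 h1]
    exact isDeterminantal_of_hasGaps (hasGaps_thinning p h0 h1)
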